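/- Let $d\ge 2$, $\beta\ge 1$ be integers, let $\mathcal S^{d-1}$ be the unit sphere of $\mathbb R^d$ with surface measure $\sigma$ and total surface $|\mathcal S^{d-1}|$ (so $|\mathcal S^0|=2$), and fix $\theta\in\mathcal S^{d-1}$. **Notation.** $P_k^d$ is the $d$-dimensional Legendre polynomial of order $k$, $$P_k^d(t)=k!\,\Gamma\!\left(\tfrac{d-1}{2}\right)\sum_{l=0}^{\lfloor k/2\rfloor}\left(-\tfrac14\right)^l\frac{(1-t^2)^l\,t^{k-2l}}{l!\,(k-2l)!\,\Gamma(l+\frac{d-1}{2})};$$ $\nu_d(k)=\binom{d+k-1}{k}-\binom{d+k-3}{k-2}$ (the second term is $0$ for $k<2$) is the dimension of the space of $d$-dimensional spherical harmonics of order $k$; $c_{j,d}(\beta)$ are the coefficients in $t^\beta=\sum_{j=0}^\beta c_{j,d}(\beta)P_j^d(t)$, $t\in[-1,1]$, with $c_{j,d}(\beta)=0$ for $j>\beta$; $\lambda_k=(c_{k,d}(\beta)/\nu_d(k))^2$ for $0<k\le\beta$ and $\lambda_k=0$ otherwise; $\psi_d(\beta)=\frac{\Gamma((\beta+1)/2)\Gamma(d/2)}{\sqrt\pi\,\Gamma((\beta+d)/2)}$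 for even $\beta$ and $\psi_d(\beta)=0$ for odd $\beta$; $\Delta_j(l)=\int_{-1}^1P_j^d(t)\,t^l(1-t^2)^{(d-3)/2}\,dt$. Further, $$I_p(\kappa)=\frac{(\kappa/2)^p}{\Gamma(p+\frac12)\Gamma(\frac12)}\int_{-1}^1e^{\kappa t}(1-t^2)^{p-1/2}dt,\qquad M(a,b,\kappa)=\frac1{B(a,b-a)}\int_{-1}^1e^{\kappa t^2}|t|^{2a-1}(1-t^2)^{b-a-1}dt$$ are the modified Bessel function of the first kind and the Kummer function, and $$A_d(\kappa)=\frac{I_{d/2}(\kappa)}{I_{d/2-1}(\kappa)},\quad a_d(\kappa)=2\pi^{d/2}\left(\tfrac\kappa2\right)^{1-d/2}I_{d/2-1}(\kappa),\quad D_d(\kappa)=\frac{M(\frac32,\frac d2+1,\kappa)}{d\,M(\frac12,\frac d2,\kappa)},\quad d_d(\kappa)=\frac{2\pi^{d/2}}{\Gamma(d/2)}M(\tfrac12,\tfrac d2,\kappa).$$ For a density $f(\cdot\,|\,\kappa)$ with respect to $\sigma$, with $f(\cdot\,|\,0)=1/|\mathcal S^{d-1}|$ the uniform density, and $U\sim f(\cdot\,|\,\kappa)$,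 put $$\mathrm{KL}(\kappa,0)=\mathbb E_\kappa\!\left[\log\frac{f(U|\kappa)}{f(U|0)}\right],\qquad \gamma_\kappa(b)=\mathbb E_\kappa(b^\top U)^\beta-\psi_d(\beta),\quad b\in\mathcal S^{d-1}.$$ In each of the following cases $\gamma_\kappa^2$ attains its maximum on $\mathcal S^{d-1}$, and the stated formulas hold. (i) **von Mises–Fisher**, $f(x|\kappa)=\frac{(\kappa/2)^{d/2-1}}{2\pi^{d/2}I_{d/2-1}(\kappa)}\exp(\kappa x^\top\theta)$, $\kappa>0$: (a) $\mathrm{KL}(\kappa,0)=A_d(\kappa)\kappa-\log a_d(\kappa)+\log|\mathcal S^{d-1}|$; (b) $\gamma_\kappa(b)=\frac{|\mathcal S^{d-2}|}{a_d(\kappa)}\sum_{l=0}^\infty\frac{\kappa^l}{l!}\sum_{j=0}^\beta c_{j,d}(\beta)\Delta_j(l)P_j^d(\theta^\top b)-\psi_d(\beta)$ for all $b\in\mathcal S^{d-1}$, the series being convergent; (c) $\lim_{\kappa\to0^+}\frac{\max_b\gamma_\kappa^2(b)}{2\mathrm{KL}(\kappa,0)}=\lambda_1\nu_d(1)$. (ii)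 **Watson**, $f(x|\kappa)=\frac{\Gamma(d/2)}{2\pi^{d/2}M(1/2,d/2,\kappa)}\exp(\kappa(x^\top\theta)^2)$, $\kappa>0$: (a) $\mathrm{KL}(\kappa,0)=D_d(\kappa)\kappa-\log d_d(\kappa)+\log|\mathcal S^{d-1}|$; (b) $\gamma_\kappa(b)=\frac{|\mathcal S^{d-2}|}{d_d(\kappa)}\sum_{l=0}^\infty\frac{\kappa^l}{l!}\sum_{j=0}^\beta c_{j,d}(\beta)\Delta_j(2l)P_j^d(\theta^\top b)-\psi_d(\beta)$ for all $b\in\mathcal S^{d-1}$, the series being convergent; (c) $\lim_{\kappa\to0^+}\frac{\max_b\gamma_\kappa^2(b)}{2\mathrm{KL}(\kappa,0)}=\lambda_2\nu_d(2)$. (iii) **Legendre polynomial alternative** of any order $m\ge1$, $f(x|\kappa)=\frac1{|\mathcal S^{d-1}|}\left(1+\kappa P_m^d(\theta^\top x)\right)$, $\kappa\in[0,1]$: (a) there is $\xi_\kappa>-1$ with $|\xi_\kappa|\le\kappa$ such that $$\mathrm{KL}(\kappa,0)=\frac{\kappa^2}{\nu_d(m)}\left(1-\frac1{2(1+\xi_\kappa)^2}\right)-\frac{\kappa^3}{2(1+\xi_\kappa)^2}\,\frac{|\mathcal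 S^{d-2}|}{|\mathcal S^{d-1}|}\int_{-1}^1\left(P_m^d(t)\right)^3(1-t^2)^{(d-3)/2}\,dt;$$ (b) $\gamma_\kappa(b)=\kappa\,\frac{c_{m,d}(\beta)}{\nu_d(m)}\,P_m^d(\theta^\top b)$ for all $b\in\mathcal S^{d-1}$; (c) $\lim_{\kappa\to0^+}\frac{\max_b\gamma_\kappa^2(b)}{2\mathrm{KL}(\kappa,0)}=\lambda_m\nu_d(m)$. -/

import Mathlib

open MeasureTheory Filter Topology Set

noncomputable section

/-- The unit sphere `S^{d-1}` of the Euclidean space `ℝ^d`. -/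
abbrev USphere (d : ℕ) : Type := Metric.sphere (0 : EuclideanSpace ℝ (Fin d)) 1

/-- The surface measure `σ` on `S^{d-1}`. -/
def surfaceMeasure (d : ℕ) : Measure (USphere d) :=
  (volume : Measure (EuclideanSpace ℝ (Fin d))).toSphere

/-- `sphereArea d` is the total surface `|S^{d-1}|` of the unit sphere of `ℝ^d`; hence
`|S^{d-2}|` is `sphereArea (d - 1)` (which is `|S^0| = 2` for `d = 2`). -/
def sphereArea (d : ℕ) : ℝ := (surfaceMeasure d).real univ

/-- The scalar product `x^⊤ y` of two points of the sphere. -/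
def sdot {d : ℕ} (x y : USphere d) : ℝ :=
  inner ℝ (x : EuclideanSpace ℝ (Fin d)) (y : EuclideanSpace ℝ (Fin d))

/-- The weight `(1 - t²)^{(d-3)/2}` on `[-1,1]`. -/
def sphereWeight (d : ℕ) (t : ℝ) : ℝ := (1 - t ^ 2) ^ (((d : ℝ) - 3) / 2)

/-- The `d`-dimensional Legendre polynomial `P_k^d` of order `k`, normalised by `P_k^d(1) = 1`. -/
def legendreP (d k : ℕ) (t : ℝ) : ℝ :=
  (k.factorial : ℝ) * Real.Gamma (((d : ℝ) - 1) / 2) *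
    ∑ l ∈ Finset.range (k / 2 + 1),
      (-(1 / 4 : ℝ)) ^ l * ((1 - t ^ 2) ^ l * t ^ (k - 2 * l)) /
        ((l.factorial : ℝ) * ((k - 2 * l).factorial : ℝ) *
          Real.Gamma ((l : ℝ) + ((d : ℝ) - 1) / 2))

/-- `ν_d(k) = C(d+k-1, k) - C(d+k-3, k-2)`, the dimension of the space of `d`-dimensional spherical
harmonics of order `k`; the second binomial coefficient is `0` if `k < 2`. -/
def harmonicDim (d k : ℕ) : ℝ :=
  ((d + k - 1).choose k : ℝ) - if k < 2 then 0 else ((d + k - 3).choose (k - 2) : ℝ)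

/-- `c` is the sequence of coefficients of the expansion
`t^n = ∑_{j=0}^n c_j P_j^d(t)`, `t ∈ [-1,1]`, continued by `0` for `j > n`. -/
def IsLegendreExpansion (d n : ℕ) (c : ℕ → ℝ) : Prop :=
  (∀ t ∈ Icc (-1 : ℝ) 1, t ^ n = ∑ j ∈ Finset.range (n + 1), c j * legendreP d j t) ∧
    ∀ j, n < j → c j = 0

open Classical in
/-- `legendreCoeff d n j` is the coefficient `c_{j,d}(n)` of `P_j^d` in the expansion of `t^n` into
Legendre polynomials. For `d ≥ 2` the expansion exists and is unique, because `P_k^d` is a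
polynomial of degree `k`. -/
def legendreCoeff (d n : ℕ) : ℕ → ℝ :=
  if h : ∃ c, IsLegendreExpansion d n c then h.choose else 0

/-- The eigenvalue `λ_k` (which depends on `d` and `β`):
`(c_{k,d}(β) / ν_d(k))²` for `0 < k ≤ β`, and `0` otherwise. -/
def lambdaEig (d β k : ℕ) : ℝ :=
  if 0 < k ∧ k ≤ β then (legendreCoeff d β k / harmonicDim d k) ^ 2 else 0

/-- `ψ_d(β)`, the `β`-th moment of `b^⊤ U` for `U` uniformly distributed on the sphere. -/
def psi (d β : ℕ) : ℝ :=
  if Even β then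
    Real.Gamma (((β : ℝ) + 1) / 2) * Real.Gamma ((d : ℝ) / 2) /
      (√Real.pi * Real.Gamma (((β : ℝ) + (d : ℝ)) / 2))
  else 0

/-- `Δ_j(l) = ∫_{-1}^1 P_j^d(t) t^l (1-t²)^{(d-3)/2} dt`. -/
def legendreDelta (d j l : ℕ) : ℝ :=
  ∫ t in (-1 : ℝ)..1, legendreP d j t * t ^ l * sphereWeight d t

/-- The modified Bessel function of the first kind `I_p(κ)`, `p ≥ 0`, `κ > 0`. -/
def besselI (p κ : ℝ) : ℝ :=
  (κ / 2) ^ p / (Real.Gamma (p + 1 / 2) * Real.Gamma (1 / 2)) *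
    ∫ t in (-1 : ℝ)..1, Real.exp (κ * t) * (1 - t ^ 2) ^ (p - 1 / 2)

/-- The Kummer function `M(a,b,κ)`, `b > a > 0`, `κ ≥ 0`. -/
def kummerM (a b κ : ℝ) : ℝ :=
  1 / ProbabilityTheory.beta a (b - a) *
    ∫ t in (-1 : ℝ)..1, Real.exp (κ * t ^ 2) * |t| ^ (2 * a - 1) * (1 - t ^ 2) ^ (b - a - 1)

/-- `A_d(κ) = I_{d/2}(κ) / I_{d/2-1}(κ)`. -/
def vmfA (d : ℕ) (κ : ℝ) : ℝ := besselI ((d : ℝ) / 2) κ / besselI ((d : ℝ) / 2 - 1) κ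

/-- `a_d(κ) = 2 π^{d/2} (κ/2)^{1-d/2} I_{d/2-1}(κ)`. -/
def vmfNorm (d : ℕ) (κ : ℝ) : ℝ :=
  2 * Real.pi ^ ((d : ℝ) / 2) * (κ / 2) ^ (1 - (d : ℝ) / 2) * besselI ((d : ℝ) / 2 - 1) κ

/-- `D_d(κ) = M(3/2, d/2+1, κ) / (d M(1/2, d/2, κ))`. -/
def watsonD (d : ℕ) (κ : ℝ) : ℝ :=
  kummerM (3 / 2) ((d : ℝ) / 2 + 1) κ / ((d : ℝ) * kummerM (1 / 2) ((d : ℝ) / 2) κ)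

/-- `d_d(κ) = 2 π^{d/2} / Γ(d/2) · M(1/2, d/2, κ)`. -/
def watsonNorm (d : ℕ) (κ : ℝ) : ℝ :=
  2 * Real.pi ^ ((d : ℝ) / 2) / Real.Gamma ((d : ℝ) / 2) * kummerM (1 / 2) ((d : ℝ) / 2) κ

/-- The density `f(· | 0)` of the uniform distribution on the sphere. -/
def uniformDensity (d : ℕ) (_x : USphere d) : ℝ := 1 / sphereArea d

/-- The density of the von Mises–Fisher distribution `vMF(θ, κ)`, `κ > 0`. -/
def vmfDensity {d : ℕ} (θ : USphere d) (κ : ℝ) (x : USphere d) : ℝ :=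
  (κ / 2) ^ ((d : ℝ) / 2 - 1) / (2 * Real.pi ^ ((d : ℝ) / 2) * besselI ((d : ℝ) / 2 - 1) κ) *
    Real.exp (κ * sdot x θ)

/-- The density of the Watson distribution `W(θ, κ)`, `κ ≥ 0`. -/
def watsonDensity {d : ℕ} (θ : USphere d) (κ : ℝ) (x : USphere d) : ℝ :=
  Real.Gamma ((d : ℝ) / 2) / (2 * Real.pi ^ ((d : ℝ) / 2) * kummerM (1 / 2) ((d : ℝ) / 2) κ) *
    Real.exp (κ * sdot x θ ^ 2)

/-- The density of the Legendre polynomial distribution `LP_m(θ, κ)`, `κ ∈ [0,1]`. -/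
def lpDensity {d : ℕ} (m : ℕ) (θ : USphere d) (κ : ℝ) (x : USphere d) : ℝ :=
  1 / sphereArea d * (1 + κ * legendreP d m (sdot θ x))

/-- The distribution on the sphere with density `f` with respect to the surface measure. -/
def sphereLaw {d : ℕ} (f : USphere d → ℝ) : Measure (USphere d) :=
  (surfaceMeasure d).withDensity fun x => ENNReal.ofReal (f x)

/-- The Kullback–Leibler information number `KL(κ,0) = E_κ[log (f(U | κ) / f(U | 0))]`, where
`f = f(· | κ)`, `U ∼ f(· | κ)`, and `f(· | 0)` is the uniform density. -/
def klNull {d : ℕ} (f : USphere d → ℝ) : ℝ :=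
  ∫ x, Real.log (f x / uniformDensity d x) ∂(sphereLaw f)

/-- `γ_κ(b) = E_κ (b^⊤ U)^β - ψ_d(β)`, where `f = f(· | κ)` and `U ∼ f(· | κ)`. -/
def gammaFun {d : ℕ} (β : ℕ) (f : USphere d → ℝ) (b : USphere d) : ℝ :=
  (∫ x, sdot b x ^ β ∂(sphereLaw f)) - psi d β

/-- `max_{b ∈ S^{d-1}} γ_κ(b)²`. -/
def maxGammaSq {d : ℕ} (β : ℕ) (f : USphere d → ℝ) : ℝ :=
  sSup (range fun b : USphere d => gammaFun β f b ^ 2)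

end

noncomputable section

/-! For small `κ` all three families have the form `|S| f = 1 + κ α P_m(θᵀx) + O(κ²)`, uniformly on
the sphere. The von Mises–Fisher and Watson densities are exponential tilts `exp(κT)/Z` with `T =
θᵀx = P_1` and `T = (θᵀx)² = 1/d + ((d-1)/d) P_2`, and the Legendre alternative has this form
without remainder. Expanding `t^β` in Legendre polynomials and using orthogonality gives `γ_κ(b) = κ
α (c_m/ν_m) P_m(θᵀb) + O(κ²)`. Since `|P_m| ≤ 1 = P_m(1)`, the maximum of the leading term is at `b
= θ`. On the other side `2 KL = E_0 u² + O(κ³)` with `u = |S| f - 1`, which is `κ² α² / ν_m` to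
leading order. In the quotient `α` cancels and `c_m²/ν_m = λ_m ν_m` remains (`tendsto_efficiency`).

The exact formulas for the tilts come from two facts: the logarithm of a tilt is affine in `T`, and
`exp(κT)` may be expanded and integrated termwise, each term being evaluated by `funk_hecke`. Bessel
and Kummer functions enter only through one-dimensional integrals, via the slicing formula
`integral_zonal`. For the Legendre alternative the remainder of the logarithm is squeezed between
two multiples of `∫ (1+u)u²`, and `ξ` is solved for after integration.

The harmonic analysis is derived from moments alone. Evaluating a Gaussian integral in polar and in
orthonormal coordinates gives the moments of `wᵀx` on the sphere. Orthogonality of the `P_k` reduces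
to a finite difference of a polynomial, and their norms to a recursion for the leading coefficients.
Funk–Hecke follows because convolution with a zonal kernel is symmetric and does not raise the
degree. -/

/-! ### Gaussian integrals and the moments of the sphere -/

theorem integral_gaussian_mul_pow_odd (n : ℕ) (hn : Odd n) :
    ∫ t : ℝ, t ^ n * Real.exp (-t ^ 2) = 0 := by
  have h := integral_neg_eq_self (fun t : ℝ => t ^ n * Real.exp (-t ^ 2)) volume
  simp only [hn.neg_pow, even_two.neg_pow, neg_mul, integral_neg] at h
  linarith

theorem integral_gaussian_mul_pow_even (l : ℕ) :
    ∫ t : ℝ, t ^ (2 * l) * Real.exp (-t ^ 2) = Real.Gamma (l + 1 / 2) := by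
  have h := integral_comp_abs (f := fun t : ℝ => t ^ (2 * l) * Real.exp (-t ^ 2))
  simp only [sq_abs, (even_two_mul l).pow_abs] at h
  rw [h]
  have h2 := integral_rpow_mul_exp_neg_rpow (p := 2) (q := 2 * l) (by norm_num)
    (by have : (0 : ℝ) ≤ l := l.cast_nonneg
        linarith)
  have : ∫ t in Ioi (0 : ℝ), t ^ (2 * l) * Real.exp (-t ^ 2) =
      ∫ x in Ioi (0 : ℝ), x ^ (2 * l : ℝ) * Real.exp (-x ^ (2 : ℝ)) := by
    refine setIntegral_congr_fun measurableSet_Ioi fun x hx => ?_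
    simp only [← Real.rpow_natCast]
    push_cast
    rfl
  rw [this, h2, add_div, mul_div_cancel_left₀ _ two_ne_zero]
  ring

theorem integral_radial_gaussian (d N : ℕ) (hd : 1 ≤ d) :
    ∫ r in Ioi (0 : ℝ), r ^ (d - 1) * (r ^ N * Real.exp (-r ^ 2)) =
      Real.Gamma (((N : ℝ) + d) / 2) / 2 := by
  have h2 := integral_rpow_mul_exp_neg_rpow (p := 2) (q := (d - 1 + N : ℕ)) (by norm_num)
    (by have : (0 : ℝ) ≤ (d - 1 + N : ℕ) := Nat.cast_nonneg _
        linarith)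
  have : ∫ r in Ioi (0 : ℝ), r ^ (d - 1) * (r ^ N * Real.exp (-r ^ 2)) =
      ∫ x in Ioi (0 : ℝ), x ^ ((d - 1 + N : ℕ) : ℝ) * Real.exp (-x ^ (2 : ℝ)) := by
    refine setIntegral_congr_fun measurableSet_Ioi fun x hx => ?_
    simp only [Real.rpow_natCast, pow_add, mul_assoc]
    norm_num
  rw [this, h2]
  push_cast [hd]
  ring_nf

/-- Polar coordinates for a homogeneous function against the Gaussian weight. -/
theorem integral_inner_pow_mul_gaussian_polar (d N : ℕ) (hd : 1 ≤ d)
    (w : EuclideanSpace ℝ (Fin d)) :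
    ∫ x : EuclideanSpace ℝ (Fin d), inner ℝ w x ^ N * Real.exp (-‖x‖ ^ 2) =
      (∫ x : USphere d, inner ℝ w (x : EuclideanSpace ℝ (Fin d)) ^ N ∂(surfaceMeasure d)) *
        (Real.Gamma (((N : ℝ) + d) / 2) / 2) := by
  have : Nonempty (Fin d) := ⟨⟨0, hd⟩⟩
  let E := EuclideanSpace ℝ (Fin d)
  have hdim : Module.finrank ℝ E = d := by simp [E]
  calc
    ∫ x : E, inner ℝ w x ^ N * Real.exp (-‖x‖ ^ 2)
      = ∫ x : ({(0 : E)}ᶜ : Set E), inner ℝ w x.1 ^ N * Real.exp (-‖x.1‖ ^ 2)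
          ∂((volume : Measure E).comap Subtype.val) := by
        rw [integral_subtype_comap (measurableSet_singleton _).compl
          fun x : E ↦ inner ℝ w x ^ N * Real.exp (-‖x‖ ^ 2), restrict_compl_singleton]
    _ = ∫ x : Metric.sphere (0 : E) 1 × Ioi (0 : ℝ),
          inner ℝ w x.1.1 ^ N * (x.2.1 ^ N * Real.exp (-x.2.1 ^ 2))
          ∂((volume : Measure E).toSphere.prod (.volumeIoiPow (Module.finrank ℝ E - 1))) := by
        rw [← (volume : Measure E).measurePreserving_homeomorphUnitSphereProd.integral_comp
          (Homeomorph.measurableEmbedding _)]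
        refine integral_congr_ae (ae_of_all _ fun x => ?_)
        have hx : ‖x.1‖ ≠ 0 := norm_ne_zero_iff.2 x.2
        simp only [homeomorphUnitSphereProd_apply_snd_coe, homeomorphUnitSphereProd_apply_fst_coe,
          inner_smul_right]
        rw [← mul_assoc, ← mul_pow]
        congr 2
        field_simp
    _ = _ := by
        rw [integral_prod_mul (fun x : Metric.sphere (0 : E) 1 => inner ℝ w x.1 ^ N)
          (fun r : Ioi (0 : ℝ) => r.1 ^ N * Real.exp (-r.1 ^ 2))]
        congr 1
        rw [← integral_radial_gaussian d N hd]
        simp only [Measure.volumeIoiPow, ENNReal.ofReal]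
        rw [integral_withDensity_eq_integral_smul, hdim,
          integral_subtype_comap measurableSet_Ioi fun a : ℝ ↦
            Real.toNNReal (a ^ (d - 1)) • (a ^ N * Real.exp (-a ^ 2)),
          setIntegral_congr_fun measurableSet_Ioi fun x hx ↦ ?_]
        · rw [NNReal.smul_def, Real.coe_toNNReal _ (pow_nonneg hx.out.le _), smul_eq_mul]
        · exact (measurable_subtype_coe.pow_const _).real_toNNReal

/-- Completing `u` to an orthonormal basis turns the inner product into a coordinate; the Gaussian
weight then factorises, and each of the other `d - 1` coordinates contributes `√π`. -/
theorem integral_inner_pow_mul_gaussian_of_norm_eq_one (d N : ℕ)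
    (u : EuclideanSpace ℝ (Fin d)) (hu : ‖u‖ = 1) :
    ∫ x : EuclideanSpace ℝ (Fin d), inner ℝ u x ^ N * Real.exp (-‖x‖ ^ 2) =
      (∫ t : ℝ, t ^ N * Real.exp (-t ^ 2)) * √Real.pi ^ (d - 1) := by
  have hd : 0 < d := by
    rcases Nat.eq_zero_or_pos d with rfl | h
    · rw [Subsingleton.elim u 0, norm_zero] at hu
      norm_num at hu
    · exact h
  let i₀ : Fin d := ⟨0, hd⟩
  obtain ⟨b, hb⟩ := Orthonormal.exists_orthonormalBasis_extension_of_card_eq (𝕜 := ℝ)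
    (E := EuclideanSpace ℝ (Fin d)) (ι := Fin d) (by simp) (v := fun _ => u) (s := {i₀})
    (by
      rw [orthonormal_iff_ite]
      rintro ⟨i, hi⟩ ⟨j, hj⟩
      simp only [mem_singleton_iff] at hi hj
      subst hi hj
      simp [hu])
  have hb0 : b i₀ = u := hb i₀ rfl
  have h1 : ∫ x : EuclideanSpace ℝ (Fin d), inner ℝ u x ^ N * Real.exp (-‖x‖ ^ 2) =
      ∫ y : EuclideanSpace ℝ (Fin d), (y i₀) ^ N * Real.exp (-‖y‖ ^ 2) := by
    rw [← b.measurePreserving_repr.integral_comp b.repr.toHomeomorph.measurableEmbedding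
      (fun y : EuclideanSpace ℝ (Fin d) => (y i₀) ^ N * Real.exp (-‖y‖ ^ 2))]
    refine integral_congr_ae (ae_of_all _ fun x => ?_)
    simp only [b.repr_apply_apply, hb0, LinearIsometryEquiv.norm_map]
  have h2 : ∫ y : EuclideanSpace ℝ (Fin d), (y i₀) ^ N * Real.exp (-‖y‖ ^ 2) =
      ∫ z : Fin d → ℝ, ∏ i, ((if i = i₀ then (z i) ^ N else 1) * Real.exp (-(z i) ^ 2)) := by
    rw [← (EuclideanSpace.volume_preserving_symm_measurableEquiv_toLp (Fin d)).symm.integral_comp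
      (MeasurableEquiv.measurableEmbedding _)]
    refine integral_congr_ae (ae_of_all _ fun x => ?_)
    simp only [Finset.prod_mul_distrib, Finset.prod_ite_eq', Finset.mem_univ, if_true,
      ← Real.exp_sum, EuclideanSpace.norm_sq_eq, Real.norm_eq_abs, sq_abs, Finset.sum_neg_distrib]
    rfl
  rw [h1, h2, integral_fintype_prod_volume_eq_prod
    (fun (i : Fin d) (t : ℝ) => (if i = i₀ then t ^ N else 1) * Real.exp (-t ^ 2))]
  rw [← Finset.mul_prod_erase _ _ (Finset.mem_univ i₀)]
  simp only [if_true]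
  congr 1
  have h3 : ∀ i ∈ Finset.univ.erase i₀,
      ∫ t : ℝ, (if i = i₀ then t ^ N else 1) * Real.exp (-t ^ 2) = √Real.pi := by
    intro i hi
    have := integral_gaussian 1
    simp only [(Finset.mem_erase.1 hi).1, if_false, one_mul]
    simpa using this
  rw [Finset.prod_congr rfl h3]
  simp

theorem integral_inner_pow_mul_gaussian (d N : ℕ) (hd : 1 ≤ d)
    (w : EuclideanSpace ℝ (Fin d)) :
    ∫ x : EuclideanSpace ℝ (Fin d), inner ℝ w x ^ N * Real.exp (-‖x‖ ^ 2) =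
      ‖w‖ ^ N * ((∫ t : ℝ, t ^ N * Real.exp (-t ^ 2)) * √Real.pi ^ (d - 1)) := by
  obtain ⟨u, hu, hw⟩ : ∃ u : EuclideanSpace ℝ (Fin d), ‖u‖ = 1 ∧ w = ‖w‖ • u := by
    by_cases h : w = 0
    · exact ⟨EuclideanSpace.single ⟨0, hd⟩ 1, by simp, by simp [h]⟩
    · refine ⟨‖w‖⁻¹ • w, ?_, ?_⟩
      · simp [norm_smul, h]
      · simp [smul_smul, h]
  rw [← integral_inner_pow_mul_gaussian_of_norm_eq_one d N u hu, ← integral_const_mul]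
  conv_lhs => rw [hw]
  simp only [real_inner_smul_left, mul_pow, mul_assoc]

/-- The moment `∫ (θ^⊤ x)^N dσ(x)` for a unit vector `θ`. -/
def sphereMoment (d N : ℕ) : ℝ :=
  if Even N then
    2 * √Real.pi ^ (d - 1) * Real.Gamma (((N : ℝ) + 1) / 2) / Real.Gamma (((N : ℝ) + d) / 2)
  else 0

/-- Two evaluations of one Gaussian integral are compared. Allowing `w` of any length matters: with
`w = v • b + θ` the identity later serves as a generating function in `v` for mixed moments. -/
theorem integral_sphere_inner_pow (d N : ℕ) (hd : 1 ≤ d) (w : EuclideanSpace ℝ (Fin d)) :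
    ∫ x : USphere d, inner ℝ w (x : EuclideanSpace ℝ (Fin d)) ^ N ∂(surfaceMeasure d) =
      ‖w‖ ^ N * sphereMoment d N := by
  have h := integral_inner_pow_mul_gaussian_polar d N hd w
  rw [integral_inner_pow_mul_gaussian d N hd w] at h
  have hd' : (1 : ℝ) ≤ d := by exact_mod_cast hd
  have hG : 0 < Real.Gamma (((N : ℝ) + d) / 2) := by
    apply Real.Gamma_pos_of_pos
    positivity
  rw [sphereMoment]
  split_ifs with hN
  · obtain ⟨l, hl⟩ := hN.two_dvd
    have h3 : ∫ t : ℝ, t ^ N * Real.exp (-t ^ 2) = Real.Gamma (((N : ℝ) + 1) / 2) := by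
      rw [hl, integral_gaussian_mul_pow_even]
      push_cast
      congr 1
      ring
    rw [h3] at h
    rw [mul_div_assoc', eq_div_iff hG.ne']
    linear_combination -2 * h
  · rw [integral_gaussian_mul_pow_odd N (Nat.not_even_iff_odd.1 hN)] at h
    simp only [zero_mul, mul_zero] at h ⊢
    rcases mul_eq_zero.1 h.symm with h | h
    · exact h
    · linarith

/-! ### Beta integrals, the weight and the surface area -/

/-- Evenness and the substitution `s = t²`. The indicators of `Iic 1` in `F` and `G` move everything
to the half-line, where the substitution is carried out. -/
theorem integral_neg_one_one_pow_mul_rpow (l : ℕ) {a : ℝ} (ha : 0 < a) :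
    ∫ t in (-1 : ℝ)..1, t ^ (2 * l) * (1 - t ^ 2) ^ (a - 1) =
      ProbabilityTheory.beta (l + 1 / 2) a := by
  have hl : (0 : ℝ) < l + 1 / 2 := by positivity
  rw [ProbabilityTheory.beta_eq_betaIntegralReal _ _ hl ha]
  let F : ℝ → ℝ := (Iic (1 : ℝ)).indicator fun t => t ^ (2 * l) * (1 - t ^ 2) ^ (a - 1)
  let G : ℝ → ℝ := (Iic (1 : ℝ)).indicator fun t => t ^ ((l : ℝ) + 1 / 2 - 1) * (1 - t) ^ (a - 1)
  have h1 : ∫ t in (-1 : ℝ)..1, t ^ (2 * l) * (1 - t ^ 2) ^ (a - 1) = ∫ t, F |t| := by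
    rw [intervalIntegral.integral_of_le (by norm_num), ← integral_Icc_eq_integral_Ioc,
      ← integral_indicator measurableSet_Icc]
    congr 1
    ext t
    by_cases ht : |t| ≤ 1
    · have : t ∈ Icc (-1 : ℝ) 1 := abs_le.1 ht
      simp only [F, indicator_of_mem this, indicator_of_mem (mem_Iic.2 ht), sq_abs,
        (even_two_mul l).pow_abs]
    · have : t ∉ Icc (-1 : ℝ) 1 := fun h => ht (abs_le.2 h)
      have h' : |t| ∉ Iic (1 : ℝ) := ht
      simp only [F, indicator_of_notMem this, indicator_of_notMem h']
  rw [h1, integral_comp_abs]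
  have h2 := integral_comp_rpow_Ioi_of_pos (g := G) (p := 2) (by norm_num)
  have h3 : ∫ x in Ioi (0 : ℝ), (2 * x ^ ((2 : ℝ) - 1)) • G (x ^ (2 : ℝ)) =
      2 * ∫ x in Ioi (0 : ℝ), F x := by
    rw [← integral_const_mul]
    refine setIntegral_congr_fun measurableSet_Ioi fun x hx => ?_
    have hx0 : 0 < x := hx
    have hx2 : x ^ (2 : ℝ) = x ^ 2 := by norm_num
    have hxm : x ^ (2 : ℝ) ∈ Iic (1 : ℝ) ↔ x ∈ Iic (1 : ℝ) := by
      rw [mem_Iic, mem_Iic, hx2]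
      exact sq_le_one_iff₀ hx0.le
    by_cases hx1 : x ∈ Iic (1 : ℝ)
    · simp only [F, G, indicator_of_mem hx1, indicator_of_mem (hxm.2 hx1), smul_eq_mul]
      have : x ^ ((2 : ℝ) - 1) * (x ^ (2 : ℝ)) ^ ((l : ℝ) + 1 / 2 - 1) = x ^ (2 * l) := by
        rw [← Real.rpow_mul hx0.le, ← Real.rpow_add hx0, ← Real.rpow_natCast]
        congr 1
        push_cast
        ring
      rw [← this, hx2]
      ring
    · simp only [F, G, indicator_of_notMem hx1, indicator_of_notMem (mt hxm.1 hx1), smul_zero,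
        mul_zero]
  rw [← h3, h2, Complex.betaIntegral]
  have h4 : ∀ x ∈ uIcc (0 : ℝ) 1, (x : ℂ) ^ (((l + 1 / 2 : ℝ) : ℂ) - 1) *
      (1 - (x : ℂ)) ^ ((a : ℂ) - 1) =
      ((x ^ ((l : ℝ) + 1 / 2 - 1) * (1 - x) ^ (a - 1) : ℝ) : ℂ) := by
    intro x hx
    rw [uIcc_of_le zero_le_one] at hx
    rw [Complex.ofReal_mul, Complex.ofReal_cpow hx.1, Complex.ofReal_cpow (by linarith [hx.2])]
    push_cast
    rfl
  rw [intervalIntegral.integral_congr h4, intervalIntegral.integral_ofReal, Complex.ofReal_re,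
    intervalIntegral.integral_of_le zero_le_one, setIntegral_indicator measurableSet_Iic,
    Ioi_inter_Iic]

theorem sphereWeight_nonneg (d : ℕ) {t : ℝ} (ht : t ∈ Icc (-1 : ℝ) 1) : 0 ≤ sphereWeight d t :=
  Real.rpow_nonneg (by nlinarith [ht.1, ht.2]) _

theorem sphereWeight_pos (d : ℕ) {t : ℝ} (ht : t ∈ Ioo (-1 : ℝ) 1) : 0 < sphereWeight d t :=
  Real.rpow_pos_of_pos (by nlinarith [ht.1, ht.2]) _

theorem sphereWeight_neg (d : ℕ) (t : ℝ) : sphereWeight d (-t) = sphereWeight d t := by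
  simp [sphereWeight]

theorem integral_pow_mul_sphereWeight_even {d : ℕ} (hd : 2 ≤ d) (l : ℕ) :
    ∫ t in (-1 : ℝ)..1, t ^ (2 * l) * sphereWeight d t =
      ProbabilityTheory.beta (l + 1 / 2) (((d : ℝ) - 1) / 2) := by
  have hd' : (2 : ℝ) ≤ d := by exact_mod_cast hd
  rw [← integral_neg_one_one_pow_mul_rpow l (a := ((d : ℝ) - 1) / 2) (by linarith)]
  simp only [sphereWeight]
  congr! 4
  ring

/-- For `d = 2` the weight is unbounded at the endpoints. Integrability is read off from the value
of the integral: a non-integrable function would have integral `0`, but a beta value is positive. -/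
theorem intervalIntegrable_sphereWeight {d : ℕ} (hd : 2 ≤ d) :
    IntervalIntegrable (sphereWeight d) volume (-1) 1 := by
  have hd' : (2 : ℝ) ≤ d := by exact_mod_cast hd
  have h := integral_pow_mul_sphereWeight_even hd 0
  simp only [mul_zero, pow_zero, one_mul, Nat.cast_zero, zero_add] at h
  by_contra hc
  rw [intervalIntegral.integral_undef hc] at h
  exact (ProbabilityTheory.beta_pos (by norm_num : (0 : ℝ) < 1 / 2)
    (by linarith : 0 < ((d : ℝ) - 1) / 2)).ne h

theorem intervalIntegrable_mul_sphereWeight {d : ℕ} (hd : 2 ≤ d) {g : ℝ → ℝ} (hg : Continuous g) :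
    IntervalIntegrable (fun t => g t * sphereWeight d t) volume (-1) 1 :=
  (intervalIntegrable_sphereWeight hd).continuousOn_mul hg.continuousOn

theorem sphereArea_eq_sphereMoment {d : ℕ} (hd : 1 ≤ d) : sphereArea d = sphereMoment d 0 := by
  have h := integral_sphere_inner_pow d 0 hd 0
  simpa [sphereArea] using h

theorem sqrt_pi_pow (n : ℕ) : √Real.pi ^ n = Real.pi ^ ((n : ℝ) / 2) := by
  rw [Real.sqrt_eq_rpow, ← Real.rpow_natCast, ← Real.rpow_mul Real.pi_pos.le]
  congr 1
  ring

theorem sphereArea_eq {d : ℕ} (hd : 1 ≤ d) :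
    sphereArea d = 2 * Real.pi ^ ((d : ℝ) / 2) / Real.Gamma ((d : ℝ) / 2) := by
  rw [sphereArea_eq_sphereMoment hd, sphereMoment, if_pos Even.zero, ← sqrt_pi_pow]
  obtain ⟨k, rfl⟩ := Nat.exists_eq_add_of_le' hd
  simp only [Nat.cast_zero, zero_add, Nat.add_sub_cancel, Real.Gamma_one_half_eq, pow_succ]
  ring

theorem sphereArea_pos {d : ℕ} (hd : 1 ≤ d) : 0 < sphereArea d := by
  have hd' : (1 : ℝ) ≤ d := by exact_mod_cast hd
  rw [sphereArea_eq hd]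
  have h2 : 0 < Real.Gamma ((d : ℝ) / 2) := Real.Gamma_pos_of_pos (by positivity)
  positivity

/-- This is slicing for monomials. It needs no fibration of the sphere: both sides have closed forms
in Gamma functions, and odd powers integrate to zero. -/
theorem sphereArea_pred_mul_integral_pow {d : ℕ} (hd : 2 ≤ d) (N : ℕ) :
    sphereArea (d - 1) * ∫ t in (-1 : ℝ)..1, t ^ N * sphereWeight d t = sphereMoment d N := by
  have hd' : (2 : ℝ) ≤ d := by exact_mod_cast hd
  rw [sphereMoment]
  split_ifs with hN
  · obtain ⟨l, rfl⟩ := hN.two_dvd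
    rw [integral_pow_mul_sphereWeight_even hd, sphereArea_eq (by lia), ← sqrt_pi_pow,
      ProbabilityTheory.beta]
    push_cast [show 1 ≤ d by lia]
    have hG : 0 < Real.Gamma (((d : ℝ) - 1) / 2) := Real.Gamma_pos_of_pos (by linarith)
    rw [show (2 * (l : ℝ) + d) / 2 = l + 1 / 2 + (d - 1) / 2 by ring,
      show (2 * (l : ℝ) + 1) / 2 = l + 1 / 2 by ring]
    field_simp
  · have h := intervalIntegral.integral_comp_neg (a := -1) (b := 1)
      (fun t : ℝ => t ^ N * sphereWeight d t)
    simp only [(Nat.not_even_iff_odd.1 hN).neg_pow, sphereWeight_neg, neg_mul,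
      intervalIntegral.integral_neg, neg_neg] at h
    rw [show ∫ t in (-1 : ℝ)..1, t ^ N * sphereWeight d t = 0 by linarith, mul_zero]

/-! ### Zonal functions and the slicing formula -/

theorem continuous_sdot_right {d : ℕ} (b : USphere d) : Continuous fun x => sdot b x := by
  unfold sdot
  fun_prop

theorem continuous_sdot {d : ℕ} : Continuous fun p : USphere d × USphere d => sdot p.1 p.2 := by
  unfold sdot
  fun_prop

theorem sdot_comm {d : ℕ} (x y : USphere d) : sdot x y = sdot y x :=
  real_inner_comm _ _

theorem sdot_self {d : ℕ} (x : USphere d) : sdot x x = 1 := by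
  simp [sdot]

theorem abs_sdot_le_one {d : ℕ} (x y : USphere d) : |sdot x y| ≤ 1 := by
  have := abs_real_inner_le_norm (x : EuclideanSpace ℝ (Fin d)) y
  simpa [sdot] using this

theorem sdot_mem {d : ℕ} (x y : USphere d) : sdot x y ∈ Icc (-1 : ℝ) 1 :=
  abs_le.1 (abs_sdot_le_one x y)

instance (d : ℕ) : IsFiniteMeasure (surfaceMeasure d) :=
  inferInstanceAs (IsFiniteMeasure (Measure.toSphere _))

theorem integrable_surfaceMeasure {d : ℕ} {g : USphere d → ℝ} (hg : Continuous g) :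
    Integrable g (surfaceMeasure d) := by
  rw [← integrableOn_univ]
  exact hg.continuousOn.integrableOn_compact isCompact_univ

theorem integrable_zonal {d : ℕ} (θ : USphere d) {g : ℝ → ℝ} (hg : Continuous g) :
    Integrable (fun x => g (sdot θ x)) (surfaceMeasure d) :=
  integrable_surfaceMeasure (hg.comp (continuous_sdot_right θ))

theorem integral_sdot_pow {d : ℕ} (hd : 1 ≤ d) (θ : USphere d) (N : ℕ) :
    ∫ x, sdot θ x ^ N ∂(surfaceMeasure d) = sphereMoment d N := by
  have := integral_sphere_inner_pow d N hd θ
  simpa [sdot] using this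

theorem integral_polynomial_sdot {d : ℕ} (hd : 2 ≤ d) (θ : USphere d) (p : Polynomial ℝ) :
    ∫ x, p.eval (sdot θ x) ∂(surfaceMeasure d) =
      sphereArea (d - 1) * ∫ t in (-1 : ℝ)..1, p.eval t * sphereWeight d t := by
  induction p using Polynomial.induction_on' with
  | add p q hp hq =>
    simp only [Polynomial.eval_add, add_mul]
    rw [integral_add (integrable_zonal θ p.continuous)
      (integrable_zonal θ q.continuous), hp, hq,
      intervalIntegral.integral_add (intervalIntegrable_mul_sphereWeight hd p.continuous)
      (intervalIntegrable_mul_sphereWeight hd q.continuous), mul_add]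
  | monomial n a =>
    simp only [Polynomial.eval_monomial, mul_assoc]
    rw [integral_const_mul, integral_sdot_pow (by lia), intervalIntegral.integral_const_mul,
      ← sphereArea_pred_mul_integral_pow hd]
    ring

theorem abs_integral_mul_sphereWeight_le {d : ℕ} (hd : 2 ≤ d) {g : ℝ → ℝ} {ε : ℝ}
    (hg : ∀ t ∈ Icc (-1 : ℝ) 1, |g t| ≤ ε) :
    |∫ t in (-1 : ℝ)..1, g t * sphereWeight d t| ≤
      ε * ∫ t in (-1 : ℝ)..1, sphereWeight d t := by
  rw [← intervalIntegral.integral_const_mul, ← Real.norm_eq_abs]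
  refine intervalIntegral.norm_integral_le_of_norm_le (by norm_num) (ae_of_all _ fun t ht => ?_)
    ((intervalIntegrable_sphereWeight hd).const_mul ε)
  have ht' : t ∈ Icc (-1 : ℝ) 1 := ⟨ht.1.le, ht.2⟩
  rw [norm_mul, Real.norm_eq_abs, Real.norm_eq_abs, abs_of_nonneg (sphereWeight_nonneg d ht')]
  exact mul_le_mul_of_nonneg_right (hg t ht') (sphereWeight_nonneg d ht')

theorem abs_integral_surfaceMeasure_le {d : ℕ} {g : USphere d → ℝ} {ε : ℝ}
    (hg : ∀ x, |g x| ≤ ε) :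
    |∫ x, g x ∂(surfaceMeasure d)| ≤ ε * sphereArea d := by
  rw [← Real.norm_eq_abs]
  exact norm_integral_le_of_norm_le_const (ae_of_all _ hg)

theorem integral_sphereWeight {d : ℕ} (hd : 2 ≤ d) :
    sphereArea (d - 1) * ∫ t in (-1 : ℝ)..1, sphereWeight d t = sphereArea d := by
  have h := sphereArea_pred_mul_integral_pow hd 0
  rw [← sphereArea_eq_sphereMoment (by lia)] at h
  simpa using h

/-- The slicing formula for zonal functions. -/
theorem integral_zonal {d : ℕ} (hd : 2 ≤ d) (θ : USphere d) {g : ℝ → ℝ} (hg : Continuous g) :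
    ∫ x, g (sdot θ x) ∂(surfaceMeasure d) =
      sphereArea (d - 1) * ∫ t in (-1 : ℝ)..1, g t * sphereWeight d t := by
  have hS := sphereArea_pos (d := d) (by lia)
  have hS' := sphereArea_pos (d := d - 1) (by lia)
  refine eq_of_forall_dist_le fun ε hε => ?_
  -- Weierstrass reduces to polynomials. Both sides have total mass `|S^{d-1}|`, so this tolerance
  -- costs `ε / 2` on each.
  obtain ⟨p, hp⟩ := exists_polynomial_near_of_continuousOn (-1) 1 g hg.continuousOn
    (ε / (2 * sphereArea d)) (by positivity)
  have h1 : |(∫ x, g (sdot θ x) ∂(surfaceMeasure d)) -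
      ∫ x, p.eval (sdot θ x) ∂(surfaceMeasure d)| ≤ ε / (2 * sphereArea d) * sphereArea d := by
    rw [← integral_sub (integrable_zonal θ hg)
      (integrable_zonal θ p.continuous)]
    refine abs_integral_surfaceMeasure_le fun x => ?_
    rw [abs_sub_comm]
    exact (hp _ (sdot_mem θ x)).le
  have h2 : |(∫ t in (-1 : ℝ)..1, g t * sphereWeight d t) -
      ∫ t in (-1 : ℝ)..1, p.eval t * sphereWeight d t| ≤
        ε / (2 * sphereArea d) * ∫ t in (-1 : ℝ)..1, sphereWeight d t := by
    rw [← intervalIntegral.integral_sub (intervalIntegrable_mul_sphereWeight hd hg)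
      (intervalIntegrable_mul_sphereWeight hd p.continuous)]
    simp only [← sub_mul]
    refine abs_integral_mul_sphereWeight_le hd fun t ht => ?_
    rw [abs_sub_comm]
    exact (hp t ht).le
  have h3 : |sphereArea (d - 1) * (∫ t in (-1 : ℝ)..1, g t * sphereWeight d t) -
      ∫ x, p.eval (sdot θ x) ∂(surfaceMeasure d)| ≤ ε / (2 * sphereArea d) * sphereArea d := by
    rw [integral_polynomial_sdot hd, ← mul_sub, abs_mul, abs_of_pos hS']
    refine (mul_le_mul_of_nonneg_left h2 hS'.le).trans_eq ?_
    rw [mul_left_comm, integral_sphereWeight hd]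
  have h4 : ε / (2 * sphereArea d) * sphereArea d = ε / 2 := by field_simp
  rw [h4] at h1 h3
  rw [Real.dist_eq]
  rw [abs_le] at *
  constructor <;> linarith [h1.1, h1.2, h3.1, h3.2]

theorem psi_eq {d β : ℕ} (hd : 1 ≤ d) : psi d β = sphereMoment d β / sphereArea d := by
  have hd' : (1 : ℝ) ≤ d := by exact_mod_cast hd
  rw [psi, sphereMoment]
  split_ifs
  · have hG : 0 < Real.Gamma ((d : ℝ) / 2) := Real.Gamma_pos_of_pos (by positivity)
    have hG2 : 0 < Real.Gamma (((β : ℝ) + d) / 2) := Real.Gamma_pos_of_pos (by positivity)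
    have hp : 0 < √Real.pi := Real.sqrt_pos.2 Real.pi_pos
    rw [sphereArea_eq hd, ← sqrt_pi_pow]
    obtain ⟨k, rfl⟩ := Nat.exists_eq_add_of_le' hd
    simp only [Nat.add_sub_cancel, pow_succ]
    field_simp
  · simp

/-! ### Legendre polynomials: values, parity and leading coefficients -/

open Polynomial in
/-- The `d`-dimensional Legendre polynomial of order `k` as a polynomial. -/
def legendrePoly (d k : ℕ) : ℝ[X] :=
  C ((k.factorial : ℝ) * Real.Gamma (((d : ℝ) - 1) / 2)) *
    ∑ l ∈ Finset.range (k / 2 + 1),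
      C ((-(1 / 4 : ℝ)) ^ l / ((l.factorial : ℝ) * ((k - 2 * l).factorial : ℝ) *
          Real.Gamma ((l : ℝ) + ((d : ℝ) - 1) / 2))) * ((1 - X ^ 2) ^ l * X ^ (k - 2 * l))

theorem eval_legendrePoly (d k : ℕ) (t : ℝ) : (legendrePoly d k).eval t = legendreP d k t := by
  simp only [legendrePoly, legendreP, Polynomial.eval_mul, Polynomial.eval_C,
    Polynomial.eval_finsetSum, Polynomial.eval_pow, Polynomial.eval_sub, Polynomial.eval_one,
    Polynomial.eval_X]
  congr 1
  refine Finset.sum_congr rfl fun l _ => ?_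
  ring

theorem continuous_legendreP (d k : ℕ) : Continuous (legendreP d k) := by
  have : legendreP d k = fun t => (legendrePoly d k).eval t :=
    funext fun t => (eval_legendrePoly d k t).symm
  rw [this]
  exact (legendrePoly d k).continuous

theorem half_pred_pos {d : ℕ} (hd : 2 ≤ d) : 0 < ((d : ℝ) - 1) / 2 := by
  have hd' : (2 : ℝ) ≤ d := by exact_mod_cast hd
  linarith

theorem Gamma_half_pred_pos {d : ℕ} (hd : 2 ≤ d) (l : ℕ) :
    0 < Real.Gamma ((l : ℝ) + ((d : ℝ) - 1) / 2) :=
  Real.Gamma_pos_of_pos (by have := half_pred_pos hd; positivity)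

theorem legendreP_one {d : ℕ} (hd : 2 ≤ d) (k : ℕ) : legendreP d k 1 = 1 := by
  rw [legendreP, Finset.sum_eq_single 0]
  · have h := Gamma_half_pred_pos hd 0
    simp only [Nat.cast_zero, zero_add] at h
    simp only [pow_zero, one_pow, mul_zero, Nat.sub_zero, Nat.factorial_zero, Nat.cast_zero,
      zero_add, Nat.cast_one, one_mul]
    have hk : (k.factorial : ℝ) ≠ 0 := by positivity
    field_simp
  · intro l _ hl
    simp [hl]
  · simp

theorem legendreP_neg (d k : ℕ) (t : ℝ) : legendreP d k (-t) = (-1) ^ k * legendreP d k t := by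
  simp only [legendreP]
  rw [mul_left_comm ((-1 : ℝ) ^ k), Finset.mul_sum (a := (-1 : ℝ) ^ k)]
  congr 1
  refine Finset.sum_congr rfl fun l hl => ?_
  have hl' : 2 * l ≤ k := by
    have := Finset.mem_range.1 hl
    lia
  have h : (-1 : ℝ) ^ k = (-1) ^ (k - 2 * l) := by
    conv_lhs => rw [← Nat.sub_add_cancel hl', pow_add, (even_two_mul l).neg_one_pow, mul_one]
  rw [neg_pow t, h, neg_sq]
  ring

/-- The moment `∫ u^n` of a coordinate of a uniform unit vector in dimension `d - 1`. -/
def equatorMoment (d n : ℕ) : ℝ :=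
  if Even n then
    (n.factorial : ℝ) * Real.Gamma (((d : ℝ) - 1) / 2) /
      (4 ^ (n / 2) * ((n / 2).factorial : ℝ) * Real.Gamma ((n / 2 : ℕ) + ((d : ℝ) - 1) / 2))
  else 0

theorem equatorMoment_recurrence {d : ℕ} (hd : 2 ≤ d) (n : ℕ) :
    equatorMoment d (n + 2) * (n + d - 1) = (n + 1) * equatorMoment d n := by
  rcases Nat.even_or_odd' n with ⟨l, rfl | rfl⟩
  · have h1 : Even (2 * l) := even_two_mul l
    have h2 : Even (2 * l + 2) := h1.add even_two
    have ha := half_pred_pos hd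
    have hG := Gamma_half_pred_pos hd l
    rw [equatorMoment, equatorMoment, if_pos h1, if_pos h2,
      show (2 * l + 2) / 2 = l + 1 by lia, show 2 * l / 2 = l by lia, Nat.factorial_succ,
      Nat.factorial_succ, Nat.factorial_succ l]
    push_cast
    have hg : Real.Gamma ((l : ℝ) + 1 + ((d : ℝ) - 1) / 2) =
        ((l : ℝ) + ((d : ℝ) - 1) / 2) * Real.Gamma ((l : ℝ) + ((d : ℝ) - 1) / 2) := by
      rw [← Real.Gamma_add_one (by positivity)]
      ring_nf
    rw [hg]
    have : (l.factorial : ℝ) ≠ 0 := by positivity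
    rw [show (2 * (l : ℝ) + d - 1) = 2 * (l + ((d : ℝ) - 1) / 2) by ring]
    have h3 : ((l : ℝ) + ((d : ℝ) - 1) / 2) ≠ 0 := by positivity
    generalize (l : ℝ) + ((d : ℝ) - 1) / 2 = y at *
    field_simp
    ring
  · have h1 : ¬ Even (2 * l + 1) := Nat.not_even_two_mul_add_one l
    have h2 : ¬ Even (2 * l + 1 + 2) := fun h => h1 ((Nat.even_add.1 h).2 even_two)
    rw [equatorMoment, equatorMoment, if_neg h1, if_neg h2]
    simp

theorem equatorMoment_one (d : ℕ) : equatorMoment d 1 = 0 := by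
  simp [equatorMoment]

theorem equatorMoment_zero {d : ℕ} (hd : 2 ≤ d) : equatorMoment d 0 = 1 := by
  have h := Gamma_half_pred_pos hd 0
  simp only [Nat.cast_zero, zero_add] at h
  simp [equatorMoment, h.ne']

/-- The linear functional on polynomials with moments `equatorMoment d`. -/
def equatorFunctional (d : ℕ) : Polynomial ℝ →ₗ[ℝ] ℝ :=
  Polynomial.lsum fun n => equatorMoment d n • LinearMap.id

theorem equatorFunctional_monomial (d n : ℕ) (a : ℝ) :
    equatorFunctional d (Polynomial.monomial n a) = equatorMoment d n * a := by
  simp [equatorFunctional, Polynomial.lsum_apply]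

-- For `d ≥ 3` the functional is integration against the probability density proportional to `(1 -
-- x²)^{(d-4)/2}`, and the identity is `∫ ((1 - x²)^{(d-2)/2} p)' = 0`. Arguing with moments also
-- covers `d = 2`, where the measure consists of two atoms at `±1`.
open Polynomial in
theorem equatorFunctional_derivative {d : ℕ} (hd : 2 ≤ d) (p : ℝ[X]) :
    equatorFunctional d ((1 - X ^ 2) * derivative p - C ((d : ℝ) - 2) * X * p) = 0 := by
  induction p using Polynomial.induction_on' with
  | add p q hp hq =>
    rw [map_add, mul_add, mul_add, add_sub_add_comm, map_add, hp, hq, add_zero]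
  | monomial n a =>
    have h2 : C ((d : ℝ) - 2) * X * monomial n a = monomial (n + 1) (((d : ℝ) - 2) * a) := by
      rw [mul_assoc, X_mul_monomial, C_mul_monomial]
    rcases n with _ | n
    · rw [h2, derivative_monomial]
      simp [equatorFunctional_monomial, equatorMoment_one]
    · have h1 : (1 - X ^ 2) * derivative (monomial (n + 1) a) =
          monomial n (a * (n + 1)) - monomial (n + 2) (a * (n + 1)) := by
        rw [derivative_monomial, sub_mul, one_mul, X_pow_mul_monomial]
        simp
      rw [h2, h1, map_sub, map_sub, equatorFunctional_monomial, equatorFunctional_monomial,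
        equatorFunctional_monomial]
      linear_combination (-a) * equatorMoment_recurrence hd n

-- Apply the integration by parts to `(1+X)^k`, for which `(1-X²) k (1+X)^{k-1} = k (1-X)(1+X)^k` is
-- again a combination of powers of `1+X`.
open Polynomial in
theorem equatorFunctional_one_add_X_pow_succ {d : ℕ} (hd : 2 ≤ d) (k : ℕ) :
    equatorFunctional d ((1 + X) ^ (k + 1)) * (k + d - 2) =
      (2 * k + d - 2) * equatorFunctional d ((1 + X) ^ k) := by
  have h := equatorFunctional_derivative hd ((1 + X) ^ k)
  have h2 : (1 - X ^ 2) * derivative ((1 + X : ℝ[X]) ^ k) - C ((d : ℝ) - 2) * X * (1 + X) ^ k =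
      (2 * k + d - 2 : ℝ) • (1 + X) ^ k - (k + d - 2 : ℝ) • (1 + X) ^ (k + 1) := by
    simp only [smul_eq_C_mul, C_sub, C_add, C_mul, map_natCast, map_ofNat]
    rcases k with _ | k
    · simp
      ring
    · rw [derivative_pow_succ]
      simp only [derivative_one, derivative_X, zero_add, mul_one, map_add, map_one,
        map_natCast]
      push_cast
      ring
  rw [h2, map_sub, map_smul, map_smul, smul_eq_mul, smul_eq_mul] at h
  linear_combination -h

open Polynomial in
theorem equatorFunctional_one_add_X_pow (d k : ℕ) :
    equatorFunctional d ((1 + X) ^ k) =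
      ∑ l ∈ Finset.range (k / 2 + 1), (k.choose (2 * l)) * equatorMoment d (2 * l) := by
  rw [add_comm, add_pow, map_sum]
  have h : ∀ i, equatorFunctional d (X ^ i * 1 ^ (k - i) * (k.choose i : ℝ[X])) =
      (k.choose i) * equatorMoment d i := by
    intro i
    have : (X ^ i * 1 ^ (k - i) * (k.choose i : ℝ[X])) = monomial i (k.choose i : ℝ) := by
      rw [one_pow, mul_one, ← C_mul_X_pow_eq_monomial, map_natCast, mul_comm]
    rw [this, equatorFunctional_monomial, mul_comm]
  simp only [h]
  rw [← Finset.sum_image (s := Finset.range (k / 2 + 1)) (g := fun l => 2 * l)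
    (f := fun i => (k.choose i : ℝ) * equatorMoment d i) (fun a _ b _ hab => by
      simp only at hab
      lia)]
  symm
  apply Finset.sum_subset
  · intro i hi
    simp only [Finset.mem_image, Finset.mem_range] at hi ⊢
    lia
  · intro i hi hi'
    have : ¬ Even i := by
      rintro ⟨l, rfl⟩
      apply hi'
      simp only [Finset.mem_image, Finset.mem_range] at hi ⊢
      exact ⟨l, by lia, by lia⟩
    simp [equatorMoment, this]

theorem natDegree_legendrePoly_le (d k : ℕ) : (legendrePoly d k).natDegree ≤ k := by
  refine (Polynomial.natDegree_C_mul_le _ _).trans ?_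
  refine Polynomial.natDegree_sum_le_of_forall_le _ _ fun l hl => ?_
  refine (Polynomial.natDegree_C_mul_le _ _).trans ?_
  have hl' : 2 * l ≤ k := by
    have := Finset.mem_range.1 hl
    lia
  refine Polynomial.natDegree_mul_le.trans ?_
  have h1 : ((1 - Polynomial.X ^ 2 : Polynomial ℝ) ^ l).natDegree ≤ l * 2 :=
    Polynomial.natDegree_pow_le_of_le l (by compute_degree)
  have h2 : (Polynomial.X ^ (k - 2 * l) : Polynomial ℝ).natDegree ≤ k - 2 * l :=
    Polynomial.natDegree_X_pow_le _
  lia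

-- The definition of `P_k` is Laplace's formula `P_k(t) = E(t + i√(1-t²) u)^k` expanded, with `u` a
-- coordinate of a uniform unit vector in dimension `d-1`. In top degree `√(1-t²)` acts like `i t`,
-- so the signs cancel and `E(1+u)^k` is left.
open Polynomial in
theorem coeff_legendrePoly {d : ℕ} (hd : 2 ≤ d) (k : ℕ) :
    (legendrePoly d k).coeff k = equatorFunctional d ((1 + X) ^ k) := by
  rw [equatorFunctional_one_add_X_pow, legendrePoly, coeff_C_mul, finsetSum_coeff,
    Finset.mul_sum]
  refine Finset.sum_congr rfl fun l hl => ?_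
  have hl' : 2 * l ≤ k := by
    have := Finset.mem_range.1 hl
    lia
  have h1 : ((1 - X ^ 2 : ℝ[X]) ^ l * X ^ (k - 2 * l)).coeff k = (-1) ^ l := by
    have h2 : ((1 - X ^ 2 : ℝ[X]) ^ l).coeff (l * 2) = (-1) ^ l := by
      rw [coeff_pow_of_natDegree_le (by compute_degree)]
      simp [coeff_one]
    conv_lhs => rw [← Nat.add_sub_cancel' hl', mul_comm 2 l]
    rw [Nat.add_sub_cancel_left, coeff_mul_X_pow, h2]
  rw [coeff_C_mul, h1, equatorMoment, if_pos (even_two_mul l), show 2 * l / 2 = l by lia,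
    Nat.choose_eq_factorial_div_factorial hl',
    Nat.cast_div (Nat.factorial_mul_factorial_dvd_factorial hl') (by positivity)]
  have hG := Gamma_half_pred_pos hd l
  have h3 : (-(1 / 4 : ℝ)) ^ l * (-1) ^ l = 1 / 4 ^ l := by
    rw [← mul_pow, ← one_div_pow]
    norm_num
  push_cast
  have e1 : ((2 * l).factorial : ℝ) ≠ 0 := by positivity
  have e2 : (l.factorial : ℝ) ≠ 0 := by positivity
  have e3 : ((k - 2 * l).factorial : ℝ) ≠ 0 := by positivity
  rw [div_mul_eq_mul_div, h3]
  field_simp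

theorem equatorMoment_nonneg {d : ℕ} (hd : 2 ≤ d) (n : ℕ) : 0 ≤ equatorMoment d n := by
  rw [equatorMoment]
  split_ifs
  · have h1 := Gamma_half_pred_pos hd 0
    simp only [Nat.cast_zero, zero_add] at h1
    have h2 := Gamma_half_pred_pos hd (n / 2)
    positivity
  · exact le_rfl

theorem coeff_legendrePoly_pos {d : ℕ} (hd : 2 ≤ d) (k : ℕ) : 0 < (legendrePoly d k).coeff k := by
  rw [coeff_legendrePoly hd, equatorFunctional_one_add_X_pow, Finset.sum_range_succ']
  have := equatorMoment_nonneg hd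
  simp only [mul_zero, equatorMoment_zero hd, Nat.choose_zero_right, Nat.cast_one, mul_one]
  refine add_pos_of_nonneg_of_pos (Finset.sum_nonneg fun l _ => ?_) one_pos
  exact mul_nonneg (by positivity) (this _)

/-! ### Orthogonality -/

/-- Up to sign the sum is the `p`-th finite difference at `0` of a polynomial of degree `n` with
leading coefficient `(-2)^n`. Since `n ≤ k` forces `n ≤ p`, with equality only for `n = k`, it is
zero or `p!` times the leading coefficient. -/
theorem alternating_sum_choose_mul_prod (k n p : ℕ) (hp : k + n = 2 * p) (hnk : n ≤ k) :
    ∑ l ∈ Finset.range (p + 1), (-1 : ℝ) ^ l * p.choose l *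
        ∏ i ∈ Finset.range n, ((k : ℝ) + 1 + i - 2 * l) =
      if n = k then 2 ^ k * (k.factorial : ℝ) else 0 := by
  let Q : Polynomial ℝ := ∏ i ∈ Finset.range n,
    (Polynomial.C (-2 : ℝ) * Polynomial.X + Polynomial.C ((k : ℝ) + 1 + i))
  have hQ : ∀ x, Q.eval x = ∏ i ∈ Finset.range n, ((k : ℝ) + 1 + i - 2 * x) := by
    intro x
    simp only [Q, Polynomial.eval_prod, Polynomial.eval_add, Polynomial.eval_mul,
      Polynomial.eval_C, Polynomial.eval_X]
    refine Finset.prod_congr rfl fun i _ => ?_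
    ring
  have hdeg1 : ∀ i : ℕ, (Polynomial.C (-2 : ℝ) * Polynomial.X +
      Polynomial.C ((k : ℝ) + 1 + i)).natDegree = 1 :=
    fun i => Polynomial.natDegree_linear (by norm_num)
  have hdeg : Q.natDegree = n := by
    rw [Polynomial.natDegree_prod _ _ fun i _ h => by
      have := hdeg1 i
      rw [h] at this
      simp at this]
    simp only [hdeg1, Finset.sum_const, Finset.card_range, smul_eq_mul, mul_one]
  have hlead : Q.leadingCoeff = (-2) ^ n := by
    have h2 : (-2 : ℝ) ≠ 0 := by norm_num
    simp only [Q, Polynomial.leadingCoeff_prod, Polynomial.leadingCoeff_linear h2,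
      Finset.prod_const, Finset.card_range]
  have hsum : ∑ l ∈ Finset.range (p + 1), (-1 : ℝ) ^ l * p.choose l *
        ∏ i ∈ Finset.range n, ((k : ℝ) + 1 + i - 2 * l) =
      (-1) ^ p * (fwdDiff 1)^[p] (fun x => Q.eval x) (0 : ℝ) := by
    rw [fwdDiff_iter_eq_sum_shift, Finset.mul_sum]
    refine Finset.sum_congr rfl fun l hl => ?_
    have hl' : l ≤ p := Nat.lt_succ_iff.1 (Finset.mem_range.1 hl)
    rw [hQ]
    have : (-1 : ℝ) ^ p * (-1) ^ (p - l) = (-1) ^ l := by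
      rw [← pow_add, show p + (p - l) = l + 2 * (p - l) by lia, pow_add,
        (even_two_mul _).neg_one_pow, mul_one]
    rw [← this]
    simp only [zsmul_eq_mul, Int.cast_mul, Int.cast_pow, Int.cast_neg, Int.cast_one,
      Int.cast_natCast, zero_add, nsmul_eq_mul, mul_one]
    ring
  rw [hsum]
  split_ifs with h
  · obtain rfl : n = p := by lia
    have := congrFun (Polynomial.fwdDiff_iter_degree_eq_factorial Q) 0
    rw [hdeg, hlead] at this
    rw [this]
    subst h
    simp only [Pi.smul_apply, smul_eq_mul]
    rw [← mul_assoc, ← mul_pow]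
    norm_num
  · rw [Polynomial.fwdDiff_iter_eq_zero_of_degree_lt (P := Q) (by lia)]
    simp

theorem Gamma_natCast_add_half (j : ℕ) :
    Real.Gamma ((j : ℝ) + 1 / 2) = ((2 * j).factorial : ℝ) * √Real.pi / (4 ^ j * j.factorial) := by
  induction j with
  | zero => simpa using Real.Gamma_one_half_eq
  | succ j ih =>
    rw [show ((j + 1 : ℕ) : ℝ) + 1 / 2 = ((j : ℝ) + 1 / 2) + 1 by push_cast; ring,
      Real.Gamma_add_one (by positivity), ih, show 2 * (j + 1) = 2 * j + 1 + 1 by lia,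
      Nat.factorial_succ, Nat.factorial_succ, Nat.factorial_succ]
    push_cast
    have : (j.factorial : ℝ) ≠ 0 := by positivity
    field_simp
    ring

theorem integral_one_sub_sq_pow_mul_pow_mul_sphereWeight {d : ℕ} (hd : 2 ≤ d) (l m : ℕ) :
    ∫ t in (-1 : ℝ)..1, (1 - t ^ 2) ^ l * t ^ (2 * m) * sphereWeight d t =
      Real.Gamma (m + 1 / 2) * Real.Gamma (l + ((d : ℝ) - 1) / 2) /
        Real.Gamma (m + l + 1 / 2 + ((d : ℝ) - 1) / 2) := by
  have ha := half_pred_pos hd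
  have h := integral_neg_one_one_pow_mul_rpow m (a := l + ((d : ℝ) - 1) / 2) (by positivity)
  rw [ProbabilityTheory.beta] at h
  rw [show (m : ℝ) + l + 1 / 2 + ((d : ℝ) - 1) / 2 = m + 1 / 2 + (l + ((d : ℝ) - 1) / 2) by ring,
    ← h, intervalIntegral.integral_of_le (by norm_num), intervalIntegral.integral_of_le (by norm_num),
    integral_Ioc_eq_integral_Ioo, integral_Ioc_eq_integral_Ioo]
  refine setIntegral_congr_fun measurableSet_Ioo fun t ht => ?_
  have hpos : 0 < 1 - t ^ 2 := by nlinarith [ht.1, ht.2]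
  simp only [sphereWeight]
  rw [mul_comm _ (t ^ (2 * m)), mul_assoc, ← Real.rpow_natCast (1 - t ^ 2), ← Real.rpow_add hpos]
  congr 2
  ring

theorem integral_legendreP_mul_pow_of_odd {d k n : ℕ} (h : Odd (k + n)) :
    ∫ t in (-1 : ℝ)..1, legendreP d k t * t ^ n * sphereWeight d t = 0 := by
  have h1 := intervalIntegral.integral_comp_neg (a := -1) (b := 1)
    (fun t : ℝ => legendreP d k t * t ^ n * sphereWeight d t)
  have h2 : ∀ t : ℝ, legendreP d k (-t) * (-t) ^ n * sphereWeight d (-t) =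
      -(legendreP d k t * t ^ n * sphereWeight d t) := by
    intro t
    rw [legendreP_neg, neg_pow t, sphereWeight_neg]
    have := h.neg_one_pow (α := ℝ)
    rw [pow_add] at this
    linear_combination (legendreP d k t * t ^ n * sphereWeight d t) * this
  simp only [h2, intervalIntegral.integral_neg, neg_neg] at h1
  linarith

/-- Each summand of `P_k` gives a beta integral. In the product the Gamma factors depending on `l`
cancel, and `(2(p-l))! / (k-2l)!` is a product of `n` linear factors in `l`, which leaves a finite
difference of order `p = (k+n)/2`. -/
theorem integral_legendreP_mul_pow {d k n : ℕ} (hd : 2 ≤ d) (hnk : n ≤ k) :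
    ∫ t in (-1 : ℝ)..1, legendreP d k t * t ^ n * sphereWeight d t =
      if n = k then (k.factorial : ℝ) * Real.Gamma (((d : ℝ) - 1) / 2) * √Real.pi /
        (2 ^ k * Real.Gamma (k + 1 / 2 + ((d : ℝ) - 1) / 2)) else 0 := by
  rcases Nat.even_or_odd (k + n) with hp | hodd
  swap
  · rw [integral_legendreP_mul_pow_of_odd hodd, if_neg]
    rintro rfl
    exact Nat.not_even_iff_odd.2 hodd ⟨n, rfl⟩
  obtain ⟨p, hp⟩ := hp.two_dvd
  have ha := half_pred_pos hd
  have hfun : ∀ t : ℝ, legendreP d k t * t ^ n * sphereWeight d t =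
      ∑ l ∈ Finset.range (k / 2 + 1), (k.factorial : ℝ) * Real.Gamma (((d : ℝ) - 1) / 2) *
        ((-(1 / 4 : ℝ)) ^ l / ((l.factorial : ℝ) * ((k - 2 * l).factorial : ℝ) *
          Real.Gamma ((l : ℝ) + ((d : ℝ) - 1) / 2))) *
        ((1 - t ^ 2) ^ l * t ^ (2 * (p - l)) * sphereWeight d t) := by
    intro t
    rw [legendreP, Finset.mul_sum, Finset.sum_mul, Finset.sum_mul]
    refine Finset.sum_congr rfl fun l hl => ?_
    have hl' := Finset.mem_range.1 hl
    rw [show 2 * (p - l) = (k - 2 * l) + n by lia, pow_add]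
    ring
  simp only [hfun]
  rw [intervalIntegral.integral_finsetSum fun l _ =>
    (intervalIntegrable_mul_sphereWeight hd (by fun_prop)).const_mul _]
  have hterm : ∀ l ∈ Finset.range (k / 2 + 1),
      ∫ t in (-1 : ℝ)..1, (k.factorial : ℝ) * Real.Gamma (((d : ℝ) - 1) / 2) *
        ((-(1 / 4 : ℝ)) ^ l / ((l.factorial : ℝ) * ((k - 2 * l).factorial : ℝ) *
          Real.Gamma ((l : ℝ) + ((d : ℝ) - 1) / 2))) *
        ((1 - t ^ 2) ^ l * t ^ (2 * (p - l)) * sphereWeight d t) =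
      (k.factorial : ℝ) * Real.Gamma (((d : ℝ) - 1) / 2) * √Real.pi /
        (4 ^ p * p.factorial * Real.Gamma (p + 1 / 2 + ((d : ℝ) - 1) / 2)) *
        ((-1 : ℝ) ^ l * p.choose l * ∏ i ∈ Finset.range n, ((k : ℝ) + 1 + i - 2 * l)) := by
    intro l hl
    have hl' := Finset.mem_range.1 hl
    have hlp : l ≤ p := by lia
    have hG := Gamma_half_pred_pos hd l
    have hG2 : 0 < Real.Gamma (p + 1 / 2 + ((d : ℝ) - 1) / 2) :=
      Real.Gamma_pos_of_pos (by positivity)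
    have hprod : ((2 * (p - l)).factorial : ℝ) = (k - 2 * l).factorial *
        ∏ i ∈ Finset.range n, ((k : ℝ) + 1 + i - 2 * l) := by
      rw [show 2 * (p - l) = (k - 2 * l) + n by lia, ← Nat.factorial_mul_ascFactorial,
        Nat.ascFactorial_eq_prod_range]
      push_cast [show 2 * l ≤ k by lia]
      congr 1
      refine Finset.prod_congr rfl fun i _ => ?_
      ring
    have h4 : (4 : ℝ) ^ p = 4 ^ (p - l) * 4 ^ l := by
      rw [← pow_add, Nat.sub_add_cancel hlp]
    have h5 : (-(1 / 4 : ℝ)) ^ l = (-1) ^ l / 4 ^ l := by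
      rw [← div_pow]
      norm_num
    rw [intervalIntegral.integral_const_mul, integral_one_sub_sq_pow_mul_pow_mul_sphereWeight hd,
      Gamma_natCast_add_half, hprod, Nat.choose_eq_factorial_div_factorial hlp,
      Nat.cast_div (Nat.factorial_mul_factorial_dvd_factorial hlp) (by positivity), h4, h5,
      show ((p - l : ℕ) : ℝ) + l = p by rw [← Nat.cast_add, Nat.sub_add_cancel hlp]]
    push_cast
    have e1 : (l.factorial : ℝ) ≠ 0 := by positivity
    have e2 : (p.factorial : ℝ) ≠ 0 := by positivity
    have e3 : ((k - 2 * l).factorial : ℝ) ≠ 0 := by positivity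
    have e4 : ((p - l).factorial : ℝ) ≠ 0 := by positivity
    generalize ∏ i ∈ Finset.range n, ((k : ℝ) + 1 + i - 2 * l) = Q
    generalize Real.Gamma (p + 1 / 2 + ((d : ℝ) - 1) / 2) = G2 at *
    generalize Real.Gamma (l + ((d : ℝ) - 1) / 2) = G at *
    field_simp
  rw [Finset.sum_congr rfl hterm, ← Finset.mul_sum]
  -- The range may be enlarged from `l ≤ k/2` to `l ≤ p`: for the new `l` the factor with index `i =
  -- 2l - k - 1` vanishes.
  have hext : ∑ l ∈ Finset.range (k / 2 + 1), ((-1 : ℝ) ^ l * p.choose l *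
        ∏ i ∈ Finset.range n, ((k : ℝ) + 1 + i - 2 * l)) =
      ∑ l ∈ Finset.range (p + 1), ((-1 : ℝ) ^ l * p.choose l *
        ∏ i ∈ Finset.range n, ((k : ℝ) + 1 + i - 2 * l)) := by
    apply Finset.sum_subset
    · intro l hl
      simp only [Finset.mem_range] at hl ⊢
      lia
    · intro l hl hl'
      simp only [Finset.mem_range] at hl hl'
      rw [Finset.prod_eq_zero (i := 2 * l - k - 1), mul_zero]
      · simp only [Finset.mem_range]
        lia
      · rw [Nat.sub_sub, Nat.cast_sub (by lia)]
        push_cast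
        ring
  rw [hext, alternating_sum_choose_mul_prod k n p hp hnk]
  split_ifs with h
  · obtain rfl : k = p := by lia
    have h4 : (4 : ℝ) ^ k = 2 ^ k * 2 ^ k := by
      rw [← mul_pow]
      norm_num
    have e2 : (k.factorial : ℝ) ≠ 0 := by positivity
    rw [h4]
    field_simp
  · rw [mul_zero]

theorem intervalIntegrable_legendreP_mul {d k : ℕ} (hd : 2 ≤ d) {g : ℝ → ℝ} (hg : Continuous g) :
    IntervalIntegrable (fun t => legendreP d k t * g t * sphereWeight d t) volume (-1) 1 :=
  intervalIntegrable_mul_sphereWeight hd ((continuous_legendreP d k).mul hg)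

theorem integral_legendreP_mul_polynomial {d k : ℕ} (hd : 2 ≤ d) (q : Polynomial ℝ)
    (hq : q.natDegree ≤ k) :
    ∫ t in (-1 : ℝ)..1, legendreP d k t * q.eval t * sphereWeight d t =
      q.coeff k * ((k.factorial : ℝ) * Real.Gamma (((d : ℝ) - 1) / 2) * √Real.pi /
        (2 ^ k * Real.Gamma (k + 1 / 2 + ((d : ℝ) - 1) / 2))) := by
  have h : ∀ t : ℝ, legendreP d k t * q.eval t * sphereWeight d t =
      ∑ i ∈ Finset.range (k + 1), q.coeff i * (legendreP d k t * t ^ i * sphereWeight d t) := by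
    intro t
    rw [Polynomial.eval_eq_sum_range' (Nat.lt_succ_of_le hq), Finset.mul_sum, Finset.sum_mul]
    refine Finset.sum_congr rfl fun i _ => ?_
    ring
  simp only [h]
  rw [intervalIntegral.integral_finsetSum fun i _ =>
    (intervalIntegrable_legendreP_mul hd (by fun_prop)).const_mul _]
  simp only [intervalIntegral.integral_const_mul]
  rw [Finset.sum_range_succ, Finset.sum_eq_zero, zero_add, integral_legendreP_mul_pow hd le_rfl,
    if_pos rfl]
  intro i hi
  have hi' := Finset.mem_range.1 hi
  rw [integral_legendreP_mul_pow hd hi'.le, if_neg hi'.ne, mul_zero]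

theorem integral_legendreP_mul_polynomial_of_lt {d k : ℕ} (hd : 2 ≤ d) (q : Polynomial ℝ)
    (hq : q.natDegree < k) :
    ∫ t in (-1 : ℝ)..1, legendreP d k t * q.eval t * sphereWeight d t = 0 := by
  rw [integral_legendreP_mul_polynomial hd q hq.le, Polynomial.coeff_eq_zero_of_natDegree_lt hq,
    zero_mul]

theorem integral_legendreP_mul_legendreP_of_ne {d j k : ℕ} (hd : 2 ≤ d) (hjk : j ≠ k) :
    ∫ t in (-1 : ℝ)..1, legendreP d j t * legendreP d k t * sphereWeight d t = 0 := by
  rcases hjk.lt_or_gt with h | h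
  · simp only [mul_comm (legendreP d j _)]
    simp only [← eval_legendrePoly d j]
    exact integral_legendreP_mul_polynomial_of_lt hd _ ((natDegree_legendrePoly_le d j).trans_lt h)
  · simp only [← eval_legendrePoly d k]
    exact integral_legendreP_mul_polynomial_of_lt hd _ ((natDegree_legendrePoly_le d k).trans_lt h)

/-! ### The dimension `ν_d(k)` and the norm of `P_k` -/

theorem harmonicDim_zero {d : ℕ} : harmonicDim d 0 = 1 := by
  simp [harmonicDim]

/-- Pascal's rule removes the subtraction. Positivity is then visible, and the right-hand side obeys
a simple recursion in `j`. -/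
theorem mul_harmonicDim {d : ℕ} (hd : 2 ≤ d) (j : ℕ) :
    (j + 1 : ℝ) * harmonicDim d (j + 1) = (2 * j + d) * ((j + d - 2).choose j : ℝ) := by
  obtain ⟨e, rfl⟩ := Nat.exists_eq_add_of_le' hd
  rcases j with _ | i
  · simp [harmonicDim]
  · rw [harmonicDim, if_neg (by lia), show e + 2 + (i + 1 + 1) - 1 = e + i + 1 + 1 + 1 by lia,
      show e + 2 + (i + 1 + 1) - 3 = e + i + 1 by lia, show i + 1 + 1 - 2 = i by lia,
      show i + 1 + (e + 2) - 2 = e + i + 1 by lia]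
    have h1 := Nat.choose_succ_right_eq (e + i + 1) (i + 1)
    rw [show e + i + 1 - (i + 1) = e by lia] at h1
    have h2 : (e + i + 1 + 1 + 1).choose (i + 1 + 1) =
        (e + i + 1).choose i + (e + i + 1).choose (i + 1) +
          ((e + i + 1).choose (i + 1) + (e + i + 1).choose (i + 1 + 1)) := by
      rw [Nat.choose_succ_succ, Nat.choose_succ_succ, Nat.choose_succ_succ (e + i + 1)]
    rw [h2]
    have h1' : (((e + i + 1).choose (i + 1 + 1) * (i + 1 + 1) : ℕ) : ℝ) =
      ((e + i + 1).choose (i + 1) * e : ℕ) := by rw [h1]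
    push_cast at h1' ⊢
    linear_combination h1'

theorem harmonicDim_pos {d : ℕ} (hd : 2 ≤ d) (k : ℕ) : 0 < harmonicDim d k := by
  rcases k with _ | j
  · simp [harmonicDim_zero]
  · have h := mul_harmonicDim hd j
    have h2 : 0 < (j + d - 2).choose j := Nat.choose_pos (by lia)
    have h3 : (0 : ℝ) < (2 * j + d) * ((j + d - 2).choose j : ℝ) := by positivity
    rw [← h] at h3
    exact (pos_iff_pos_of_mul_pos h3).1 (by positivity)

/-- Induction on `j`: the recursions for the leading coefficient, the Gamma function and the
binomial coefficient fit together. It starts in degree `1` because the recursion for `(1+X)^k`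
degenerates to `0 = 0` at `k = 0`, `d = 2`. -/
theorem equatorFunctional_mul_choose {d : ℕ} (hd : 2 ≤ d) (j : ℕ) :
    equatorFunctional d ((1 + Polynomial.X) ^ (j + 1)) *
      (((j + 1).factorial : ℝ) * Real.Gamma (1 / 2 + ((d : ℝ) - 1) / 2) /
        (2 ^ (j + 1) * Real.Gamma ((j + 1 : ℕ) + 1 / 2 + ((d : ℝ) - 1) / 2))) *
        ((2 * j + d) * ((j + d - 2).choose j : ℝ)) = j + 1 := by
  have ha := half_pred_pos hd
  have hd' : (2 : ℝ) ≤ d := by exact_mod_cast hd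
  have hGs : ∀ k : ℕ, Real.Gamma ((k + 1 : ℕ) + 1 / 2 + ((d : ℝ) - 1) / 2) =
      ((2 * k + d) / 2) * Real.Gamma (k + 1 / 2 + ((d : ℝ) - 1) / 2) := by
    intro k
    rw [show ((k + 1 : ℕ) : ℝ) + 1 / 2 + ((d : ℝ) - 1) / 2 =
      (k + 1 / 2 + ((d : ℝ) - 1) / 2) + 1 by push_cast; ring, Real.Gamma_add_one (by positivity)]
    congr 1
    ring
  have hGpos : ∀ k : ℕ, 0 < Real.Gamma (k + 1 / 2 + ((d : ℝ) - 1) / 2) :=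
    fun k => Real.Gamma_pos_of_pos (by positivity)
  induction j with
  | zero =>
    have hS : equatorFunctional d ((1 + Polynomial.X) ^ (0 + 1)) = 1 := by
      rw [equatorFunctional_one_add_X_pow]
      simp [equatorMoment_zero hd]
    have hG0 := hGpos 0
    rw [hS, hGs 0]
    simp only [Nat.cast_zero, zero_add] at hG0 ⊢
    generalize Real.Gamma (1 / 2 + ((d : ℝ) - 1) / 2) = g at *
    simp
    field_simp
  | succ j ih =>
    have hS := equatorFunctional_one_add_X_pow_succ hd (j + 1)
    have hC : (((j + d - 1 : ℕ) * (j + d - 2).choose j : ℕ) : ℝ) =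
        ((j + 1 + d - 2).choose (j + 1) * (j + 1) : ℕ) := by
      have := Nat.add_one_mul_choose_eq (j + d - 2) j
      rw [show j + d - 2 + 1 = j + d - 1 by lia] at this
      rw [this, show j + 1 + d - 2 = j + d - 1 by lia]
    rw [hGs (j + 1), Nat.factorial_succ (j + 1)]
    have hG := hGpos (j + 1)
    push_cast [show 1 ≤ j + d by lia] at *
    have hj : (0 : ℝ) < j + d - 1 := by linarith [j.cast_nonneg (α := ℝ)]
    generalize Real.Gamma (1 / 2 + ((d : ℝ) - 1) / 2) = g at *
    generalize Real.Gamma ((j : ℝ) + 1 + 1 / 2 + ((d : ℝ) - 1) / 2) = G at *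
    generalize equatorFunctional d ((1 + Polynomial.X) ^ (j + 1)) = S at *
    generalize equatorFunctional d ((1 + Polynomial.X) ^ (j + 1 + 1)) = S' at *
    generalize ((j + d - 2).choose j : ℝ) = c at *
    generalize ((j + 1 + d - 2).choose (j + 1) : ℝ) = c' at *
    have hden : (2 * ((j : ℝ) + 1) + d) ≠ 0 := by positivity
    have hfac : ((j + 1).factorial : ℝ) ≠ 0 := by positivity
    have hj1 : (0 : ℝ) < j + 1 := by positivity
    have hL : S' * (((j : ℝ) + 1 + 1) * ((j + 1).factorial : ℝ) * g /
        (2 ^ (j + 1 + 1) * ((2 * ((j : ℝ) + 1) + d) / 2 * G))) * ((2 * (j + 1) + d) * c') =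
        (j + 2) * (S' * ((j + 1).factorial * g / (2 ^ (j + 1) * G)) * c') := by
      field_simp
      ring
    rw [hL]
    generalize ((j + 1).factorial * g / (2 ^ (j + 1) * G)) = K at *
    have h1 : (S' * K * c') * ((j + d - 1) * (j + 1)) = 1 * ((j + d - 1) * (j + 1)) := by
      linear_combination K * c' * (j + 1) * hS - (2 * j + d) * S * K * hC + (j + d - 1) * ih
    rw [mul_right_cancel₀ (by positivity) h1]
    ring

/-- In `∫ P_k · P_k` only the leading coefficient of the second factor counts, so this is `ν_d(k) ·
E_0 P_k² = 1` before the surface areas are inserted. -/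
theorem coeff_legendrePoly_mul {d : ℕ} (hd : 2 ≤ d) (k : ℕ) :
    (legendrePoly d k).coeff k * ((k.factorial : ℝ) * Real.Gamma (1 / 2 + ((d : ℝ) - 1) / 2) /
      (2 ^ k * Real.Gamma (k + 1 / 2 + ((d : ℝ) - 1) / 2))) * harmonicDim d k = 1 := by
  have ha := half_pred_pos hd
  have hGpos : ∀ k : ℕ, 0 < Real.Gamma (k + 1 / 2 + ((d : ℝ) - 1) / 2) :=
    fun k => Real.Gamma_pos_of_pos (by positivity)
  have hG0 := hGpos 0
  simp only [Nat.cast_zero, zero_add] at hG0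
  rw [coeff_legendrePoly hd]
  rcases k with _ | j
  · have h0 : equatorFunctional d 1 = 1 := by
      have := equatorFunctional_monomial d 0 1
      rwa [equatorMoment_zero hd, mul_one, Polynomial.monomial_zero_one] at this
    simp only [pow_zero, h0, Nat.factorial_zero, Nat.cast_one, Nat.cast_zero, zero_add, one_mul,
      harmonicDim_zero, mul_one, div_self hG0.ne']
  · have hj : (0 : ℝ) < j + 1 := by positivity
    have key := equatorFunctional_mul_choose hd j
    rw [← mul_harmonicDim hd] at key
    have := mul_left_cancel₀ hj.ne' ((mul_left_comm _ _ _).symm.trans (key.trans (mul_one _).symm))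
    exact this

/-- `E_0 P_k(θ^⊤ U)² = 1/ν_d(k)`, in terms of the weight. -/
theorem sphereArea_pred_mul_integral_legendreP_sq {d : ℕ} (hd : 2 ≤ d) (k : ℕ) :
    sphereArea (d - 1) * ∫ t in (-1 : ℝ)..1, legendreP d k t * legendreP d k t * sphereWeight d t =
      sphereArea d / harmonicDim d k := by
  have ha := half_pred_pos hd
  have h := integral_legendreP_mul_polynomial hd (legendrePoly d k) (natDegree_legendrePoly_le d k)
  simp only [eval_legendrePoly] at h
  rw [h, eq_div_iff (harmonicDim_pos hd k).ne', sphereArea_eq (by lia), sphereArea_eq (by lia),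
    ← sqrt_pi_pow, ← sqrt_pi_pow]
  have hc := coeff_legendrePoly_mul hd k
  have h1 : 0 < Real.Gamma (((d : ℝ) - 1) / 2) := Real.Gamma_pos_of_pos ha
  have h2 : 0 < Real.Gamma ((d : ℝ) / 2) := Real.Gamma_pos_of_pos (by linarith)
  have h3 : 0 < Real.Gamma (k + 1 / 2 + ((d : ℝ) - 1) / 2) := Real.Gamma_pos_of_pos (by positivity)
  rw [show (1 / 2 + ((d : ℝ) - 1) / 2) = d / 2 by ring] at hc
  obtain ⟨n, rfl⟩ : ∃ n, d = n + 1 := ⟨d - 1, by lia⟩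
  rw [Nat.add_sub_cancel, pow_succ]
  rw [show ((n : ℝ) / 2) = (((n + 1 : ℕ) : ℝ) - 1) / 2 by push_cast; ring]
  generalize Real.Gamma ((((n + 1 : ℕ) : ℝ) - 1) / 2) = G1 at *
  generalize Real.Gamma (((n + 1 : ℕ) : ℝ) / 2) = G2 at *
  generalize Real.Gamma (k + 1 / 2 + (((n + 1 : ℕ) : ℝ) - 1) / 2) = G3 at *
  field_simp at hc ⊢
  linear_combination hc

/-! ### Zonal convolutions and the Funk–Hecke formula -/

theorem integrable_sdot_pow_mul_sdot_pow {d : ℕ} (b θ : USphere d) (i j : ℕ) :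
    Integrable (fun x => sdot b x ^ i * sdot θ x ^ j) (surfaceMeasure d) :=
  integrable_surfaceMeasure (((continuous_sdot_right b).pow i).mul ((continuous_sdot_right θ).pow j))

theorem integrable_legendreP_mul {d : ℕ} (b : USphere d) (j : ℕ) {g : USphere d → ℝ}
    (hg : Continuous g) :
    Integrable (fun x => legendreP d j (sdot b x) * g x) (surfaceMeasure d) :=
  integrable_surfaceMeasure
    (((continuous_legendreP d j).comp (continuous_sdot_right b)).mul hg)

/-- The mixed moments `∫ (b^⊤x)^a (θ^⊤x)^n` are polynomials in `b^⊤θ` of degree at most `a`. -/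
theorem exists_polynomial_mixed_moment {d : ℕ} (hd : 1 ≤ d) (a n : ℕ) :
    ∃ q : Polynomial ℝ, q.natDegree ≤ a ∧ ∀ b θ : USphere d,
      ∫ x, sdot b x ^ a * sdot θ x ^ n ∂(surfaceMeasure d) = q.eval (sdot b θ) := by
  -- The mixed moment is read off as the coefficient of `v^a` in `∫ ((v b + θ)ᵀx)^{a+n}`. For even
  -- `a + n` this integral is a constant times a power of `2sv + 1 + v²`, where `s = bᵀθ`. Every `s`
  -- comes with a `v`, so the coefficient of `v^a` has degree at most `a` in `s`.
  obtain ⟨q, hqdeg, hq⟩ : ∃ q : Polynomial ℝ, q.natDegree ≤ a ∧ ∀ b θ : USphere d,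
      ∃ R : Polynomial ℝ, R.coeff a = q.eval (sdot b θ) ∧ ∀ v : ℝ,
        R.eval v = ‖(v • b + θ : EuclideanSpace ℝ (Fin d))‖ ^ (a + n) *
          sphereMoment d (a + n) := by
    rcases Nat.even_or_odd' (a + n) with ⟨p, hp | hp⟩
    · let κ : ℕ → ℝ := fun i =>
        (Polynomial.X ^ i * (1 + Polynomial.X ^ 2) ^ (p - i) : Polynomial ℝ).coeff a
      refine ⟨∑ i ∈ Finset.range (p + 1),
        Polynomial.C (2 ^ i * κ i * p.choose i * sphereMoment d (a + n)) * Polynomial.X ^ i,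
        ?_, ?_⟩
      · refine Polynomial.natDegree_sum_le_of_forall_le _ _ fun i _ => ?_
        by_cases hi : i ≤ a
        · exact (Polynomial.natDegree_C_mul_X_pow_le _ _).trans hi
        · have : κ i = 0 := by simp only [κ, Polynomial.coeff_X_pow_mul', if_neg hi]
          simp [this]
      · intro b θ
        set s := sdot b θ
        refine ⟨Polynomial.C (sphereMoment d (a + n)) * (Polynomial.C (2 * s) * Polynomial.X +
          (1 + Polynomial.X ^ 2)) ^ p, ?_, ?_⟩
        · rw [add_pow, Polynomial.coeff_C_mul, Polynomial.finsetSum_coeff, Finset.mul_sum,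
            Polynomial.eval_finsetSum]
          refine Finset.sum_congr rfl fun i _ => ?_
          have h1 : (Polynomial.C (2 * s) * Polynomial.X) ^ i * (1 + Polynomial.X ^ 2) ^ (p - i) *
              (p.choose i : Polynomial ℝ) = Polynomial.C ((2 * s) ^ i * p.choose i) *
              (Polynomial.X ^ i * (1 + Polynomial.X ^ 2) ^ (p - i)) := by
            simp only [Polynomial.C_mul, Polynomial.C_pow, map_natCast]
            ring
          rw [h1, Polynomial.coeff_C_mul]
          simp only [Polynomial.eval_mul, Polynomial.eval_C, Polynomial.eval_pow,
            Polynomial.eval_X, κ]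
          ring
        · intro v
          have h2 : ‖(v • b + θ : EuclideanSpace ℝ (Fin d))‖ ^ 2 = 2 * s * v + (1 + v ^ 2) := by
            rw [norm_add_sq_real, norm_smul, real_inner_smul_left]
            simp only [norm_eq_of_mem_sphere, mul_one, Real.norm_eq_abs, sq_abs, s, sdot]
            ring
          rw [hp, pow_mul, h2]
          simp [mul_comm]
    · refine ⟨0, by simp, fun b θ => ⟨0, by simp, fun v => ?_⟩⟩
      have : ¬ Even (a + n) := by
        rw [hp]
        exact Nat.not_even_two_mul_add_one p
      simp [sphereMoment, this]
  refine ⟨Polynomial.C (((a + n).choose a : ℝ)⁻¹) * q,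
    (Polynomial.natDegree_C_mul_le _ _).trans hqdeg, fun b θ => ?_⟩
  obtain ⟨R, hRa, hR⟩ := hq b θ
  -- The second expansion of the same generating function, by the binomial theorem under the
  -- integral.
  have hL : R = ∑ i ∈ Finset.range (a + n + 1), Polynomial.C (((a + n).choose i : ℝ) *
      ∫ x, sdot b x ^ i * sdot θ x ^ (a + n - i) ∂(surfaceMeasure d)) * Polynomial.X ^ i := by
    refine Polynomial.funext fun v => ?_
    rw [hR, ← integral_sphere_inner_pow d (a + n) hd, Polynomial.eval_finsetSum]
    have h1 : ∀ x : USphere d, (inner ℝ (v • b + θ : EuclideanSpace ℝ (Fin d)) x : ℝ) ^ (a + n) =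
        ∑ i ∈ Finset.range (a + n + 1), ((a + n).choose i * v ^ i : ℝ) *
          (sdot b x ^ i * sdot θ x ^ (a + n - i)) := by
      intro x
      rw [inner_add_left, real_inner_smul_left, add_pow]
      refine Finset.sum_congr rfl fun i _ => ?_
      simp only [sdot]
      ring
    simp only [h1]
    rw [integral_finsetSum _ fun i _ => (integrable_sdot_pow_mul_sdot_pow b θ i _).const_mul _]
    refine Finset.sum_congr rfl fun i _ => ?_
    rw [integral_const_mul]
    simp only [Polynomial.eval_mul, Polynomial.eval_C, Polynomial.eval_pow, Polynomial.eval_X]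
    ring
  have hcoef : R.coeff a = ((a + n).choose a : ℝ) *
      ∫ x, sdot b x ^ a * sdot θ x ^ n ∂(surfaceMeasure d) := by
    rw [hL]
    simp only [Polynomial.finsetSum_coeff, Polynomial.coeff_C_mul_X_pow]
    rw [Finset.sum_ite_eq, if_pos (by simp), Nat.add_sub_cancel_left]
  have hch : ((a + n).choose a : ℝ) ≠ 0 := by
    exact_mod_cast (Nat.choose_pos (Nat.le_add_right a n)).ne'
  rw [Polynomial.eval_mul, Polynomial.eval_C, ← hRa, hcoef, inv_mul_cancel_left₀ hch]

theorem exists_polynomial_zonal_convolution {d : ℕ} (hd : 1 ≤ d) (p k : Polynomial ℝ) :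
    ∃ q : Polynomial ℝ, q.natDegree ≤ p.natDegree ∧ ∀ b θ : USphere d,
      ∫ x, p.eval (sdot b x) * k.eval (sdot θ x) ∂(surfaceMeasure d) = q.eval (sdot b θ) := by
  choose Q hQdeg hQ using fun a n => exists_polynomial_mixed_moment hd a n
  refine ⟨∑ i ∈ Finset.range (p.natDegree + 1), ∑ j ∈ Finset.range (k.natDegree + 1),
    Polynomial.C (p.coeff i * k.coeff j) * Q i j, ?_, fun b θ => ?_⟩
  · refine Polynomial.natDegree_sum_le_of_forall_le _ _ fun i hi => ?_
    refine Polynomial.natDegree_sum_le_of_forall_le _ _ fun j _ => ?_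
    refine (Polynomial.natDegree_C_mul_le _ _).trans ((hQdeg i j).trans ?_)
    exact Nat.lt_succ_iff.1 (Finset.mem_range.1 hi)
  · have h : ∀ x, p.eval (sdot b x) * k.eval (sdot θ x) =
        ∑ i ∈ Finset.range (p.natDegree + 1), ∑ j ∈ Finset.range (k.natDegree + 1),
          (p.coeff i * k.coeff j) * (sdot b x ^ i * sdot θ x ^ j) := by
      intro x
      rw [p.eval_eq_sum_range, k.eval_eq_sum_range, Finset.sum_mul_sum]
      refine Finset.sum_congr rfl fun i _ => Finset.sum_congr rfl fun j _ => ?_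
      ring
    have hint : ∀ i j, Integrable (fun x => (p.coeff i * k.coeff j) *
        (sdot b x ^ i * sdot θ x ^ j)) (surfaceMeasure d) := fun i j =>
      (integrable_sdot_pow_mul_sdot_pow b θ i j).const_mul _
    simp only [h]
    rw [integral_finsetSum _ fun i _ => integrable_finsetSum _ fun j _ => hint i j,
      Polynomial.eval_finsetSum]
    refine Finset.sum_congr rfl fun i _ => ?_
    rw [integral_finsetSum _ fun j _ => hint i j, Polynomial.eval_finsetSum]
    refine Finset.sum_congr rfl fun j _ => ?_
    rw [integral_const_mul, hQ, Polynomial.eval_mul, Polynomial.eval_C]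

/-- The weight is positive on the open interval, so `r` vanishes almost everywhere there, whereas a
nonzero polynomial has finitely many roots. -/
theorem polynomial_eq_zero_of_integral_sq {d : ℕ} (hd : 2 ≤ d) (r : Polynomial ℝ)
    (h : ∫ t in (-1 : ℝ)..1, r.eval t * r.eval t * sphereWeight d t = 0) : r = 0 := by
  by_contra hr
  have hint := intervalIntegrable_mul_sphereWeight hd (r.continuous.fun_mul r.continuous)
  rw [intervalIntegrable_iff_integrableOn_Ioo_of_le (by norm_num)] at hint
  rw [intervalIntegral.integral_of_le (by norm_num), integral_Ioc_eq_integral_Ioo,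
    setIntegral_eq_zero_iff_of_nonneg_ae _ hint] at h
  · rw [EventuallyEq, ae_restrict_iff' measurableSet_Ioo] at h
    have hfin : (r.rootSet ℝ).Finite := Polynomial.rootSet_finite r ℝ
    have h2 : ∀ᵐ t : ℝ, t ∉ r.rootSet ℝ := hfin.countable.ae_notMem _
    have h3 : ∀ᵐ t : ℝ, t ∉ Ioo (-1 : ℝ) 1 := by
      filter_upwards [h, h2] with t ht ht2 hmem
      apply ht2
      have h4 := ht hmem
      simp only [Pi.zero_apply, mul_eq_zero, or_self, (sphereWeight_pos d hmem).ne', or_false] at h4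
      rw [Polynomial.mem_rootSet]
      exact ⟨hr, by simpa using h4⟩
    have h5 : volume (Ioo (-1 : ℝ) 1) = 0 := by
      rw [measure_eq_zero_iff_ae_notMem]
      exact h3
    rw [Real.volume_Ioo] at h5
    norm_num at h5
  · refine (ae_restrict_mem measurableSet_Ioo).mono fun t ht => ?_
    exact mul_nonneg (mul_self_nonneg _) (sphereWeight_pos d ht).le

theorem integrable_prod_surfaceMeasure {d : ℕ} {g : USphere d × USphere d → ℝ}
    (hg : Continuous g) : Integrable g ((surfaceMeasure d).prod (surfaceMeasure d)) := by
  rw [← integrableOn_univ]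
  exact hg.continuousOn.integrableOn_compact isCompact_univ

/-- The Funk–Hecke formula for polynomial kernels. -/
theorem funk_hecke {d : ℕ} (hd : 2 ≤ d) (j : ℕ) (k : Polynomial ℝ) (b θ : USphere d) :
    ∫ x, legendreP d j (sdot b x) * k.eval (sdot θ x) ∂(surfaceMeasure d) =
      sphereArea (d - 1) * (∫ t in (-1 : ℝ)..1, legendreP d j t * k.eval t * sphereWeight d t) *
        legendreP d j (sdot b θ) := by
  have hS' : 0 < sphereArea (d - 1) := sphereArea_pos (by lia)
  obtain ⟨Q, hQdeg, hQ⟩ := exists_polynomial_zonal_convolution (d := d) (by lia)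
    (legendrePoly d j) k
  replace hQdeg := hQdeg.trans (natDegree_legendrePoly_le d j)
  have hA := coeff_legendrePoly_pos hd j
  set c := Q.coeff j / (legendrePoly d j).coeff j with hc
  -- The convolution `Q` of `P_j` with `k` has degree at most `j`; let `r` be what remains after
  -- matching the coefficient of degree `j`. By Fubini `∫ Q r` equals the integral of `P_j` against
  -- the convolution of `r` with `k`, a polynomial of degree below `j`, hence zero. So `r` is
  -- orthogonal to `Q` and to `P_j`, therefore to itself.
  have hQP : Q = Polynomial.C c * legendrePoly d j := by
    rw [← sub_eq_zero]
    set r := Q - Polynomial.C c * legendrePoly d j with hr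
    by_contra hr0
    have hrdeg : r.natDegree < j := by
      rw [Polynomial.natDegree_lt_iff_degree_lt hr0, Polynomial.degree_lt_iff_coeff_zero]
      intro m hm
      rcases hm.eq_or_lt with rfl | hm
      · rw [hr, Polynomial.coeff_sub, Polynomial.coeff_C_mul, hc, div_mul_cancel₀ _ hA.ne',
          sub_self]
      · rw [hr, Polynomial.coeff_sub, Polynomial.coeff_C_mul,
          Polynomial.coeff_eq_zero_of_natDegree_lt (hQdeg.trans_lt hm),
          Polynomial.coeff_eq_zero_of_natDegree_lt
            ((natDegree_legendrePoly_le d j).trans_lt hm), mul_zero, sub_zero]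
    obtain ⟨q, hqdeg, hq⟩ := exists_polynomial_zonal_convolution (d := d) (by lia) r k
    have h1 : ∫ y, Q.eval (sdot b y) * r.eval (sdot b y) ∂(surfaceMeasure d) = 0 := by
      calc ∫ y, Q.eval (sdot b y) * r.eval (sdot b y) ∂(surfaceMeasure d)
          = ∫ y, ∫ x, (legendrePoly d j).eval (sdot b x) *
              (r.eval (sdot b y) * k.eval (sdot x y))
              ∂(surfaceMeasure d) ∂(surfaceMeasure d) := by
            refine integral_congr_ae (ae_of_all _ fun y => ?_)
            simp only [← hQ]
            rw [← integral_mul_const]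
            refine integral_congr_ae (ae_of_all _ fun x => ?_)
            simp only [sdot_comm x y]
            ring
        _ = ∫ x, ∫ y, (legendrePoly d j).eval (sdot b x) *
              (r.eval (sdot b y) * k.eval (sdot x y))
              ∂(surfaceMeasure d) ∂(surfaceMeasure d) := by
            refine integral_integral_swap (integrable_prod_surfaceMeasure ?_)
            have c1 : Continuous fun p : USphere d × USphere d => sdot b p.1 :=
              (continuous_sdot_right b).comp continuous_fst
            have c2 : Continuous fun p : USphere d × USphere d => sdot b p.2 :=
              (continuous_sdot_right b).comp continuous_snd
            have c3 : Continuous fun p : USphere d × USphere d => sdot p.2 p.1 :=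
              continuous_sdot.comp continuous_swap
            exact ((legendrePoly d j).continuous.comp c2).mul
              ((r.continuous.comp c1).mul (k.continuous.comp c3))
        _ = ∫ x, ((legendrePoly d j) * q).eval (sdot b x) ∂(surfaceMeasure d) := by
            refine integral_congr_ae (ae_of_all _ fun x => ?_)
            simp only [integral_const_mul, hq, Polynomial.eval_mul]
        _ = 0 := by
            rw [integral_polynomial_sdot hd]
            simp only [Polynomial.eval_mul, eval_legendrePoly]
            rw [integral_legendreP_mul_polynomial_of_lt hd q (hqdeg.trans_lt hrdeg), mul_zero]
    have h2 : ∫ t in (-1 : ℝ)..1, Q.eval t * r.eval t * sphereWeight d t = 0 := by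
      have h3 := integral_polynomial_sdot hd b (Q * r)
      simp only [Polynomial.eval_mul, h1] at h3
      exact (mul_eq_zero.1 h3.symm).resolve_left hS'.ne'
    apply hr0
    apply polynomial_eq_zero_of_integral_sq hd
    have h4 : ∀ t : ℝ, r.eval t * r.eval t * sphereWeight d t =
        Q.eval t * r.eval t * sphereWeight d t -
          c * (legendreP d j t * r.eval t * sphereWeight d t) := by
      intro t
      rw [← eval_legendrePoly]
      conv_lhs => rw [show r.eval t * r.eval t = (Q.eval t - c * (legendrePoly d j).eval t) *
        r.eval t by simp [hr]]
      ring
    simp only [h4]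
    rw [intervalIntegral.integral_sub, h2, intervalIntegral.integral_const_mul,
      integral_legendreP_mul_polynomial_of_lt hd r hrdeg, mul_zero, sub_zero]
    · exact intervalIntegrable_mul_sphereWeight hd (Q.continuous.mul r.continuous)
    · exact (intervalIntegrable_legendreP_mul hd r.continuous).const_mul _
  have hval : ∀ b θ : USphere d, ∫ x, legendreP d j (sdot b x) * k.eval (sdot θ x)
      ∂(surfaceMeasure d) = c * legendreP d j (sdot b θ) := by
    intro b θ
    have := hQ b θ
    simpa only [hQP, Polynomial.eval_mul, Polynomial.eval_C, eval_legendrePoly] using this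
  rw [hval]
  congr 1
  -- The eigenvalue is found on the diagonal, where `P_j(1) = 1`, and slicing turns it into the
  -- weighted integral.
  have h5 := hval b b
  rw [sdot_self, legendreP_one hd, mul_one] at h5
  rw [← h5, ← integral_zonal hd b (g := fun t => legendreP d j t * k.eval t)
    ((continuous_legendreP d j).mul k.continuous)]

theorem integral_legendreP_mul_legendreP {d : ℕ} (hd : 2 ≤ d) (j m : ℕ) (b θ : USphere d) :
    ∫ x, legendreP d j (sdot b x) * legendreP d m (sdot θ x) ∂(surfaceMeasure d) =
      if j = m then sphereArea d / harmonicDim d m * legendreP d m (sdot b θ) else 0 := by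
  have h := funk_hecke hd j (legendrePoly d m) b θ
  simp only [eval_legendrePoly] at h
  rw [h]
  split_ifs with hjm
  · subst hjm
    rw [sphereArea_pred_mul_integral_legendreP_sq hd]
  · rw [integral_legendreP_mul_legendreP_of_ne hd hjm]
    simp

theorem integral_legendreP_sq {d : ℕ} (hd : 2 ≤ d) (m : ℕ) (θ : USphere d) :
    ∫ x, legendreP d m (sdot θ x) * legendreP d m (sdot θ x) ∂(surfaceMeasure d) =
      sphereArea d / harmonicDim d m := by
  rw [integral_legendreP_mul_legendreP hd, if_pos rfl, sdot_self, legendreP_one hd, mul_one]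

theorem legendreP_zero {d : ℕ} (hd : 2 ≤ d) (t : ℝ) : legendreP d 0 t = 1 := by
  have h := legendreP_one hd 0
  simpa [legendreP] using h

theorem integral_legendreP {d : ℕ} (hd : 2 ≤ d) {m : ℕ} (hm : m ≠ 0) (θ : USphere d) :
    ∫ x, legendreP d m (sdot θ x) ∂(surfaceMeasure d) = 0 := by
  have h := integral_legendreP_mul_legendreP hd m 0 θ θ
  simpa [legendreP_zero hd, hm] using h

theorem continuous_legendreP_sdot {d : ℕ} (m : ℕ) (θ : USphere d) :
    Continuous fun x => legendreP d m (sdot θ x) :=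
  (continuous_legendreP d m).comp (continuous_sdot_right θ)

/-- `P_m(bᵀθ)` is `ν/|S|` times the inner product of the zonal functions at `b` and `θ`. These have
the same norm, so `2|xy| ≤ x² + y²` under the integral suffices. -/
theorem abs_legendreP_sdot_le_one {d : ℕ} (hd : 2 ≤ d) (m : ℕ) (b θ : USphere d) :
    |legendreP d m (sdot b θ)| ≤ 1 := by
  have hpos : 0 < sphereArea d / harmonicDim d m :=
    div_pos (sphereArea_pos (by lia)) (harmonicDim_pos hd m)
  have h := integral_legendreP_mul_legendreP hd m m b θ
  rw [if_pos rfl] at h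
  have hi : ∀ b θ : USphere d, Integrable
      (fun x => legendreP d m (sdot b x) * legendreP d m (sdot θ x)) (surfaceMeasure d) :=
    fun b θ => integrable_surfaceMeasure
      ((continuous_legendreP_sdot m b).mul (continuous_legendreP_sdot m θ))
  have h1 : |∫ x, legendreP d m (sdot b x) * legendreP d m (sdot θ x) ∂(surfaceMeasure d)| ≤
      ∫ x, (1 / 2 : ℝ) * (legendreP d m (sdot b x) * legendreP d m (sdot b x) +
        legendreP d m (sdot θ x) * legendreP d m (sdot θ x)) ∂(surfaceMeasure d) := by
    refine (abs_integral_le_integral_abs).trans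
      (integral_mono (hi b θ).abs (((hi b b).add (hi θ θ)).const_mul _) fun x => ?_)
    simp only
    rw [abs_le]
    constructor <;> nlinarith [sq_nonneg (legendreP d m (sdot b x) + legendreP d m (sdot θ x)),
      sq_nonneg (legendreP d m (sdot b x) - legendreP d m (sdot θ x))]
  rw [integral_const_mul, integral_add (hi b b) (hi θ θ), integral_legendreP_sq hd,
    integral_legendreP_sq hd, h, abs_mul, abs_of_pos hpos] at h1
  refine le_of_mul_le_mul_left ?_ hpos
  linarith

/-! ### Expansion of powers and the integrals it yields -/

theorem exists_legendre_expansion {d : ℕ} (hd : 2 ≤ d) (n : ℕ) (q : Polynomial ℝ)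
    (hq : q.degree < n) : ∃ c : ℕ → ℝ,
      q = ∑ j ∈ Finset.range n, Polynomial.C (c j) * legendrePoly d j := by
  induction n generalizing q with
  | zero =>
    refine ⟨0, ?_⟩
    simpa using hq
  | succ n ih =>
    have hA := coeff_legendrePoly_pos hd n
    obtain ⟨c, hc⟩ := ih (q - Polynomial.C (q.coeff n / (legendrePoly d n).coeff n) *
      legendrePoly d n) (by
        rw [Polynomial.degree_lt_iff_coeff_zero]
        intro m hm
        rcases hm.eq_or_lt with rfl | hm
        · rw [Polynomial.coeff_sub, Polynomial.coeff_C_mul, div_mul_cancel₀ _ hA.ne', sub_self]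
        · rw [Polynomial.coeff_sub, Polynomial.coeff_C_mul,
            (Polynomial.degree_lt_iff_coeff_zero _ _).1 hq m hm,
            Polynomial.coeff_eq_zero_of_natDegree_lt
              ((natDegree_legendrePoly_le d n).trans_lt hm), mul_zero, sub_zero])
    refine ⟨Function.update c n (q.coeff n / (legendrePoly d n).coeff n), ?_⟩
    rw [Finset.sum_range_succ, Function.update_self, ← sub_eq_iff_eq_add, hc]
    refine Finset.sum_congr rfl fun j hj => ?_
    rw [Function.update_of_ne (Finset.mem_range.1 hj).ne]

/-- The coefficients are a chosen sequence, and the later arguments use only this specification;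
uniqueness plays no role. -/
theorem isLegendreExpansion_legendreCoeff {d : ℕ} (hd : 2 ≤ d) (n : ℕ) :
    IsLegendreExpansion d n (legendreCoeff d n) := by
  have h : ∃ c, IsLegendreExpansion d n c := by
    obtain ⟨c, hc⟩ := exists_legendre_expansion hd (n + 1) (Polynomial.X ^ n) (by
      rw [Polynomial.degree_X_pow]
      exact_mod_cast Nat.lt_succ_self n)
    refine ⟨fun j => if j ≤ n then c j else 0, fun t _ => ?_, fun j hj => if_neg hj.not_ge⟩
    have h1 := congrArg (Polynomial.eval t) hc
    rw [Polynomial.eval_finsetSum] at h1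
    simp only [Polynomial.eval_mul, Polynomial.eval_C, eval_legendrePoly, Polynomial.eval_pow,
      Polynomial.eval_X] at h1
    rw [h1]
    refine Finset.sum_congr rfl fun j hj => ?_
    simp only [if_pos (Nat.lt_succ_iff.1 (Finset.mem_range.1 hj))]
  rw [legendreCoeff, dif_pos h]
  exact h.choose_spec

theorem sdot_pow_eq_sum {d : ℕ} (hd : 2 ≤ d) (β : ℕ) (b x : USphere d) :
    sdot b x ^ β = ∑ j ∈ Finset.range (β + 1),
      legendreCoeff d β j * legendreP d j (sdot b x) :=
  (isLegendreExpansion_legendreCoeff hd β).1 _ (sdot_mem b x)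

/-- The source of the first-order term of `γ_κ`. Only the component of order `m` of `t^β` survives;
for `m > β` both sides vanish because the coefficients are continued by zero. -/
theorem integral_sdot_pow_mul_legendreP {d : ℕ} (hd : 2 ≤ d) (β m : ℕ) (b θ : USphere d) :
    ∫ x, sdot b x ^ β * legendreP d m (sdot θ x) ∂(surfaceMeasure d) =
      sphereArea d * (legendreCoeff d β m / harmonicDim d m * legendreP d m (sdot b θ)) := by
  simp only [sdot_pow_eq_sum hd β b, Finset.sum_mul, mul_assoc]
  rw [integral_finsetSum _ fun j _ => (integrable_legendreP_mul b j
    (continuous_legendreP_sdot m θ)).const_mul _]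
  simp only [integral_const_mul, integral_legendreP_mul_legendreP hd, mul_ite, mul_zero,
    Finset.sum_ite_eq', Finset.mem_range]
  split_ifs with h
  · ring
  · rw [(isLegendreExpansion_legendreCoeff hd β).2 m (by lia)]
    simp

theorem integral_sdot_pow_mul_sdot_pow {d : ℕ} (hd : 2 ≤ d) (β l : ℕ) (b θ : USphere d) :
    ∫ x, sdot b x ^ β * sdot θ x ^ l ∂(surfaceMeasure d) =
      sphereArea (d - 1) * ∑ j ∈ Finset.range (β + 1),
        legendreCoeff d β j * legendreDelta d j l * legendreP d j (sdot θ b) := by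
  simp only [sdot_pow_eq_sum hd β b, Finset.sum_mul, mul_assoc]
  rw [integral_finsetSum _ fun j _ => (integrable_legendreP_mul b j
    ((continuous_sdot_right θ).fun_pow l)).const_mul _,
    Finset.mul_sum]
  refine Finset.sum_congr rfl fun j _ => ?_
  have h := funk_hecke hd j (Polynomial.X ^ l) b θ
  simp only [Polynomial.eval_pow, Polynomial.eval_X] at h
  rw [integral_const_mul, h, legendreDelta, sdot_comm θ b]
  ring

/-! ### Moments, information number and maximum for a continuous density -/

theorem integral_sphereLaw {d : ℕ} {f : USphere d → ℝ} (hf : Continuous f) (hf0 : ∀ x, 0 ≤ f x)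
    (g : USphere d → ℝ) :
    ∫ x, g x ∂(sphereLaw f) = ∫ x, f x * g x ∂(surfaceMeasure d) := by
  rw [sphereLaw, integral_withDensity_eq_integral_toReal_smul
    (f := fun x => ENNReal.ofReal (f x)) (ENNReal.measurable_ofReal.comp hf.measurable) (ae_of_all _ fun x => ENNReal.ofReal_lt_top)]
  simp only [ENNReal.toReal_ofReal (hf0 _), smul_eq_mul]

theorem gammaFun_eq {d : ℕ} (β : ℕ) {f : USphere d → ℝ} (hf : Continuous f)
    (hf0 : ∀ x, 0 ≤ f x) (b : USphere d) :
    gammaFun β f b = (∫ x, f x * sdot b x ^ β ∂(surfaceMeasure d)) - psi d β := by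
  rw [gammaFun, integral_sphereLaw hf hf0]

theorem klNull_eq {d : ℕ} {f : USphere d → ℝ} (hf : Continuous f) (hf0 : ∀ x, 0 ≤ f x) :
    klNull f = ∫ x, f x * Real.log (sphereArea d * f x) ∂(surfaceMeasure d) := by
  rw [klNull, integral_sphereLaw hf hf0]
  simp only [uniformDensity, div_div_eq_mul_div, div_one, mul_comm (f _) (sphereArea d)]

theorem continuous_gammaFun {d : ℕ} (β : ℕ) {f : USphere d → ℝ} (hf : Continuous f)
    (hf0 : ∀ x, 0 ≤ f x) : Continuous (gammaFun β f) := by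
  have h : gammaFun β f =
      fun b => (∫ x in univ, f x * sdot b x ^ β ∂(surfaceMeasure d)) - psi d β := by
    funext b
    rw [gammaFun_eq β hf hf0, setIntegral_univ]
  rw [h]
  refine (continuous_parametric_integral_of_continuous ?_ isCompact_univ).sub continuous_const
  exact (hf.comp continuous_snd).mul (continuous_sdot.pow β)

theorem isGreatest_maxGammaSq {d : ℕ} (β : ℕ) {f : USphere d → ℝ} (hf : Continuous f)
    (hf0 : ∀ x, 0 ≤ f x) (θ : USphere d) :
    IsGreatest (range fun b : USphere d => gammaFun β f b ^ 2) (maxGammaSq β f) := by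
  have := Nonempty.intro θ
  exact (isCompact_range ((continuous_gammaFun β hf hf0).pow 2)).isGreatest_sSup
    (range_nonempty _)

/-! ### Exponential tilts -/

/-- The density proportional to `exp (κ T)`. -/
def tiltDensity {d : ℕ} (T : USphere d → ℝ) (κ : ℝ) (x : USphere d) : ℝ :=
  Real.exp (κ * T x) / ∫ y, Real.exp (κ * T y) ∂(surfaceMeasure d)

theorem integral_exp_mul_pos {d : ℕ} (hd : 1 ≤ d) {T : USphere d → ℝ} (hT : Continuous T) (κ : ℝ) :
    0 < ∫ y, Real.exp (κ * T y) ∂(surfaceMeasure d) := by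
  have hne : NeZero (surfaceMeasure d) := ⟨fun h => by
    have := sphereArea_pos hd
    simp [sphereArea, h] at this⟩
  exact integral_exp_pos (f := fun y => κ * T y)
    (integrable_surfaceMeasure (by fun_prop))

theorem continuous_tiltDensity {d : ℕ} {T : USphere d → ℝ} (hT : Continuous T) (κ : ℝ) :
    Continuous (tiltDensity T κ) := by
  unfold tiltDensity
  fun_prop

theorem tiltDensity_nonneg {d : ℕ} (T : USphere d → ℝ) (κ : ℝ) (x : USphere d) :
    0 ≤ tiltDensity T κ x :=
  div_nonneg (Real.exp_pos _).le (integral_nonneg fun _ => (Real.exp_pos _).le)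

theorem integral_tiltDensity {d : ℕ} (hd : 1 ≤ d) {T : USphere d → ℝ} (hT : Continuous T) (κ : ℝ) :
    ∫ x, tiltDensity T κ x ∂(surfaceMeasure d) = 1 := by
  simp only [tiltDensity]
  rw [integral_div, div_self (integral_exp_mul_pos hd hT κ).ne']

theorem klNull_tiltDensity {d : ℕ} (hd : 1 ≤ d) {T : USphere d → ℝ} (hT : Continuous T) (κ : ℝ) :
    klNull (tiltDensity T κ) =
      (∫ x, T x * Real.exp (κ * T x) ∂(surfaceMeasure d)) /
        (∫ x, Real.exp (κ * T x) ∂(surfaceMeasure d)) * κ -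
      Real.log (∫ x, Real.exp (κ * T x) ∂(surfaceMeasure d)) + Real.log (sphereArea d) := by
  have hZ := integral_exp_mul_pos hd hT κ
  have hS := sphereArea_pos hd
  have h1 := integral_tiltDensity hd hT κ
  rw [klNull_eq (continuous_tiltDensity hT κ) (tiltDensity_nonneg T κ)]
  set Z := ∫ x, Real.exp (κ * T x) ∂(surfaceMeasure d) with hZdef
  have h : ∀ x, tiltDensity T κ x * Real.log (sphereArea d * tiltDensity T κ x) =
      κ / Z * (T x * Real.exp (κ * T x)) +
        (Real.log (sphereArea d) - Real.log Z) * tiltDensity T κ x := by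
    intro x
    have hx : tiltDensity T κ x = Real.exp (κ * T x) / Z := rfl
    rw [hx, Real.log_mul hS.ne' (div_pos (Real.exp_pos _) hZ).ne',
      Real.log_div (Real.exp_pos _).ne' hZ.ne', Real.log_exp]
    ring
  simp only [h]
  rw [integral_add (integrable_surfaceMeasure (by fun_prop))
    ((integrable_surfaceMeasure (continuous_tiltDensity hT κ)).const_mul _),
    integral_const_mul, integral_const_mul, h1]
  ring

/-- The `l`-th term of the exponential series is at most `κ^l / l!` in absolute value, so the
integrals of the norms are summable and sum and integral may be exchanged. -/
theorem hasSum_integral_mul_exp {d : ℕ} {g T : USphere d → ℝ} (hg : Continuous g)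
    (hT : Continuous T) (hg1 : ∀ x, |g x| ≤ 1) (hT1 : ∀ x, |T x| ≤ 1) {κ : ℝ} (hκ : 0 ≤ κ) :
    HasSum (fun l : ℕ => κ ^ l / (l.factorial : ℝ) * ∫ x, g x * T x ^ l ∂(surfaceMeasure d))
      (∫ x, g x * Real.exp (κ * T x) ∂(surfaceMeasure d)) := by
  have hint : ∀ l : ℕ, Integrable (fun x => κ ^ l / (l.factorial : ℝ) * (g x * T x ^ l))
      (surfaceMeasure d) := fun l => integrable_surfaceMeasure (by fun_prop)
  have hsum : Summable fun l : ℕ =>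
      ∫ x, ‖κ ^ l / (l.factorial : ℝ) * (g x * T x ^ l)‖ ∂(surfaceMeasure d) := by
    refine Summable.of_nonneg_of_le (fun l => integral_nonneg fun _ => norm_nonneg _) (fun l => ?_)
      ((Real.summable_pow_div_factorial κ).mul_right (sphereArea d))
    refine (le_abs_self _).trans (abs_integral_surfaceMeasure_le fun x => ?_)
    rw [abs_norm, norm_mul, Real.norm_of_nonneg (by positivity), Real.norm_eq_abs, abs_mul, abs_pow]
    refine mul_le_of_le_one_right (by positivity) ?_
    exact mul_le_one₀ (hg1 x) (by positivity) (pow_le_one₀ (abs_nonneg _) (hT1 x))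
  have h := hasSum_integral_of_summable_integral_norm hint hsum
  simp only [integral_const_mul] at h
  convert! h using 1
  refine integral_congr_ae (ae_of_all _ fun x => ?_)
  have he : HasSum (fun l : ℕ => (κ * T x) ^ l / (l.factorial : ℝ)) (Real.exp (κ * T x)) := by
    rw [Real.exp_eq_exp_ℝ]
    exact NormedSpace.expSeries_div_hasSum_exp _
  refine (he.mul_left (g x)).tsum_eq.symm.trans ?_
  refine tsum_congr fun l => ?_
  rw [mul_pow]
  ring

/-- Common form for both tilts: `s` will be `|S^{d-2}|` and `u l` the finite Legendre sum that
evaluates the `l`-th mixed moment. -/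
theorem hasSum_gammaFun_tiltDensity {d : ℕ} (β : ℕ) {T : USphere d → ℝ} (hT : Continuous T)
    (hT1 : ∀ x, |T x| ≤ 1) {κ : ℝ} (hκ : 0 ≤ κ) (b : USphere d) {s : ℝ} (hs : 0 < s)
    {u : ℕ → ℝ} (hu : ∀ l, ∫ x, sdot b x ^ β * T x ^ l ∂(surfaceMeasure d) = s * u l) :
    Summable (fun l : ℕ => κ ^ l / (l.factorial : ℝ) * u l) ∧
      gammaFun β (tiltDensity T κ) b =
        s / (∫ x, Real.exp (κ * T x) ∂(surfaceMeasure d)) *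
          (∑' l : ℕ, κ ^ l / (l.factorial : ℝ) * u l) - psi d β := by
  have h := hasSum_integral_mul_exp (g := fun x => sdot b x ^ β)
    ((continuous_sdot_right b).pow β) hT
    (fun x => by rw [abs_pow]; exact pow_le_one₀ (abs_nonneg _) (abs_sdot_le_one b x)) hT1 hκ
  simp only [hu] at h
  have h2 : HasSum (fun l : ℕ => κ ^ l / (l.factorial : ℝ) * u l)
      ((∫ x, sdot b x ^ β * Real.exp (κ * T x) ∂(surfaceMeasure d)) / s) := by
    convert! h.div_const s using 1
    funext l
    field_simp
  refine ⟨h2.summable, ?_⟩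
  rw [h2.tsum_eq, gammaFun_eq β (continuous_tiltDensity hT κ) (tiltDensity_nonneg T κ)]
  have h3 : ∀ x, tiltDensity T κ x * sdot b x ^ β = (sdot b x ^ β * Real.exp (κ * T x)) /
      ∫ x, Real.exp (κ * T x) ∂(surfaceMeasure d) := by
    intro x
    rw [tiltDensity]
    ring
  simp only [h3]
  rw [integral_div]
  field_simp

/-! ### Normalising constants in terms of Bessel and Kummer functions -/

theorem sphereArea_pred_eq {d : ℕ} (hd : 2 ≤ d) :
    sphereArea (d - 1) =
      2 * Real.pi ^ ((d : ℝ) / 2) / (√Real.pi * Real.Gamma (((d : ℝ) - 1) / 2)) := by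
  obtain ⟨n, rfl⟩ : ∃ n, d = n + 1 := ⟨d - 1, by lia⟩
  have hG := Real.Gamma_pos_of_pos (half_pred_pos hd)
  rw [sphereArea_eq (by lia), ← sqrt_pi_pow, ← sqrt_pi_pow, Nat.add_sub_cancel, pow_succ]
  push_cast at hG ⊢
  rw [add_sub_cancel_right] at hG ⊢
  field_simp

theorem besselI_pred {d : ℕ} (κ : ℝ) :
    besselI ((d : ℝ) / 2 - 1) κ = (κ / 2) ^ ((d : ℝ) / 2 - 1) /
      (Real.Gamma (((d : ℝ) - 1) / 2) * √Real.pi) *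
        ∫ t in (-1 : ℝ)..1, Real.exp (κ * t) * sphereWeight d t := by
  rw [besselI, Real.Gamma_one_half_eq]
  simp only [sphereWeight]
  rw [show (d : ℝ) / 2 - 1 + 1 / 2 = (d - 1) / 2 by ring,
    show (d : ℝ) / 2 - 1 - 1 / 2 = (d - 3) / 2 by ring]

theorem rpow_half_mul {κ : ℝ} (hκ : 0 < κ) (e : ℝ) :
    (κ / 2) ^ (1 - e) * (κ / 2) ^ (e - 1) = 1 := by
  rw [← Real.rpow_add (by positivity)]
  simp

theorem vmfNorm_eq {d : ℕ} (hd : 2 ≤ d) {κ : ℝ} (hκ : 0 < κ) (θ : USphere d) :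
    vmfNorm d κ = ∫ x, Real.exp (κ * sdot θ x) ∂(surfaceMeasure d) := by
  rw [integral_zonal hd θ (g := fun t => Real.exp (κ * t)) (by fun_prop), vmfNorm, besselI_pred,
    sphereArea_pred_eq hd]
  linear_combination (2 * Real.pi ^ ((d : ℝ) / 2) / (√Real.pi * Real.Gamma (((d : ℝ) - 1) / 2)) *
    ∫ t in (-1 : ℝ)..1, Real.exp (κ * t) * sphereWeight d t) * rpow_half_mul hκ ((d : ℝ) / 2)

theorem vmfDensity_eq {d : ℕ} (hd : 2 ≤ d) {κ : ℝ} (hκ : 0 < κ) (θ : USphere d) :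
    vmfDensity θ κ = tiltDensity (fun x => sdot θ x) κ := by
  funext x
  rw [vmfDensity, tiltDensity, ← vmfNorm_eq hd hκ, vmfNorm, sdot_comm x θ]
  have h := rpow_half_mul hκ ((d : ℝ) / 2)
  have h1 : 0 < (κ / 2) ^ (1 - (d : ℝ) / 2) := by positivity
  rw [show (κ / 2) ^ ((d : ℝ) / 2 - 1) = 1 / (κ / 2) ^ (1 - (d : ℝ) / 2) by
    rw [eq_div_iff h1.ne', mul_comm, h]]
  field_simp

/-- Integration of the derivative of `e^{κt}(1-t²)^{(d-1)/2}`; the boundary terms vanish as the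
exponent is positive. This links the integral in `I_{d/2}` with the mean of `θᵀU`. -/
theorem mul_integral_exp_mul_rpow {d : ℕ} (hd : 2 ≤ d) (κ : ℝ) :
    κ * ∫ t in (-1 : ℝ)..1, Real.exp (κ * t) * (1 - t ^ 2) ^ ((d : ℝ) / 2 - 1 / 2) =
      ((d : ℝ) - 1) * ∫ t in (-1 : ℝ)..1, t * Real.exp (κ * t) * sphereWeight d t := by
  have ha := half_pred_pos hd
  have he : (d : ℝ) / 2 - 1 / 2 = (d - 1) / 2 := by ring
  rw [he]
  have hc : Continuous fun t : ℝ => (1 - t ^ 2) ^ (((d : ℝ) - 1) / 2) :=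
    Continuous.rpow_const (by fun_prop) fun _ => Or.inr ha.le
  have hi1 : IntervalIntegrable (fun t : ℝ => κ * (Real.exp (κ * t) *
      (1 - t ^ 2) ^ (((d : ℝ) - 1) / 2))) volume (-1) 1 :=
    Continuous.intervalIntegrable (by fun_prop) _ _
  have hi2 : IntervalIntegrable (fun t : ℝ => ((d : ℝ) - 1) * (t * Real.exp (κ * t) *
      sphereWeight d t)) volume (-1) 1 :=
    (intervalIntegrable_mul_sphereWeight hd (by fun_prop)).const_mul _
  have h := intervalIntegral.integral_eq_sub_of_hasDerivAt_of_le (a := -1) (b := 1)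
    (f := fun t => Real.exp (κ * t) * (1 - t ^ 2) ^ (((d : ℝ) - 1) / 2))
    (f' := fun t => κ * (Real.exp (κ * t) * (1 - t ^ 2) ^ (((d : ℝ) - 1) / 2)) -
      ((d : ℝ) - 1) * (t * Real.exp (κ * t) * sphereWeight d t)) (by norm_num)
    (Continuous.continuousOn (by fun_prop)) (fun t ht => by
      have hpos : 0 < 1 - t ^ 2 := by nlinarith [ht.1, ht.2]
      have h1 : HasDerivAt (fun t : ℝ => Real.exp (κ * t)) (Real.exp (κ * t) * κ) t := by
        simpa using ((hasDerivAt_id t).const_mul κ).exp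
      have h2 : HasDerivAt (fun t : ℝ => 1 - t ^ 2) (-(2 * t)) t := by
        simpa using ((hasDerivAt_pow 2 t).const_sub 1)
      have h3 := h1.mul (h2.rpow_const (p := ((d : ℝ) - 1) / 2) (Or.inl hpos.ne'))
      convert! h3 using 1
      rw [sphereWeight, show (d - 1 : ℝ) / 2 - 1 = (d - 3) / 2 by ring]
      ring) (hi1.sub hi2)
  rw [intervalIntegral.integral_sub hi1 hi2, intervalIntegral.integral_const_mul,
    intervalIntegral.integral_const_mul] at h
  norm_num [Real.zero_rpow ha.ne'] at h
  linarith

theorem vmfA_eq {d : ℕ} (hd : 2 ≤ d) {κ : ℝ} (hκ : 0 < κ) (θ : USphere d) :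
    vmfA d κ = (∫ x, sdot θ x * Real.exp (κ * sdot θ x) ∂(surfaceMeasure d)) /
      ∫ x, Real.exp (κ * sdot θ x) ∂(surfaceMeasure d) := by
  have hZ := integral_exp_mul_pos (d := d) (by lia) (continuous_sdot_right θ) κ
  have ha := half_pred_pos hd
  have hG := Real.Gamma_pos_of_pos ha
  have hparts := mul_integral_exp_mul_rpow hd κ
  rw [integral_zonal hd θ (g := fun t => Real.exp (κ * t)) (by fun_prop)] at hZ ⊢
  rw [integral_zonal hd θ (g := fun t => t * Real.exp (κ * t)) (by fun_prop)]
  have hS' : 0 < sphereArea (d - 1) := sphereArea_pos (by lia)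
  have hJ := (pos_iff_pos_of_mul_pos hZ).1 hS'
  rw [vmfA, besselI_pred, besselI, Real.Gamma_one_half_eq,
    show (d : ℝ) / 2 + 1 / 2 = (d - 1) / 2 + 1 by ring, Real.Gamma_add_one ha.ne']
  have hp : (κ / 2) ^ ((d : ℝ) / 2) = (κ / 2) ^ ((d : ℝ) / 2 - 1) * (κ / 2) := by
    rw [← Real.rpow_add_one (by positivity)]
    congr 1
    ring
  have hk : 0 < (κ / 2) ^ ((d : ℝ) / 2 - 1) := by positivity
  rw [hp]
  have hd1 : 0 < (d : ℝ) - 1 := by linarith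
  rw [show (d : ℝ) / 2 - 1 / 2 = (d - 1) / 2 by ring] at hparts ⊢
  field_simp
  linear_combination hparts

theorem watsonNorm_eq {d : ℕ} (hd : 2 ≤ d) (κ : ℝ) (θ : USphere d) :
    watsonNorm d κ = ∫ x, Real.exp (κ * sdot θ x ^ 2) ∂(surfaceMeasure d) := by
  have ha := half_pred_pos hd
  rw [integral_zonal hd θ (g := fun t => Real.exp (κ * t ^ 2)) (by fun_prop), watsonNorm,
    sphereArea_pred_eq hd, kummerM, ProbabilityTheory.beta, Real.Gamma_one_half_eq,
    show (1 / 2 : ℝ) + ((d : ℝ) / 2 - 1 / 2) = d / 2 by ring,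
    show (d : ℝ) / 2 - 1 / 2 - 1 = (d - 3) / 2 by ring,
    show (d : ℝ) / 2 - 1 / 2 = (d - 1) / 2 by ring]
  have hG : 0 < Real.Gamma ((d : ℝ) / 2) := Real.Gamma_pos_of_pos (by linarith)
  simp only [sphereWeight]
  norm_num
  field_simp

theorem watsonDensity_eq {d : ℕ} (hd : 2 ≤ d) (κ : ℝ) (θ : USphere d) :
    watsonDensity θ κ = tiltDensity (fun x => sdot θ x ^ 2) κ := by
  funext x
  have ha := half_pred_pos hd
  have hG : 0 < Real.Gamma ((d : ℝ) / 2) := Real.Gamma_pos_of_pos (by linarith)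
  rw [watsonDensity, tiltDensity, ← watsonNorm_eq hd κ, watsonNorm, sdot_comm x θ]
  field_simp

/-- No integration by parts is needed: at `a = 3/2` the factor `|t|^{2a-1}` is already `t²`. The `d`
in the definition of `D_d` cancels through `Γ(d/2+1) = (d/2)Γ(d/2)` and `Γ(3/2) = Γ(1/2)/2`. -/
theorem watsonD_eq {d : ℕ} (hd : 2 ≤ d) (κ : ℝ) (θ : USphere d) :
    watsonD d κ = (∫ x, sdot θ x ^ 2 * Real.exp (κ * sdot θ x ^ 2) ∂(surfaceMeasure d)) /
      ∫ x, Real.exp (κ * sdot θ x ^ 2) ∂(surfaceMeasure d) := by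
  have ha := half_pred_pos hd
  have hd0 : 0 < (d : ℝ) / 2 := by linarith
  have hG : 0 < Real.Gamma ((d : ℝ) / 2) := Real.Gamma_pos_of_pos hd0
  have hG' := Real.Gamma_pos_of_pos ha
  have hM : kummerM (3 / 2) ((d : ℝ) / 2 + 1) κ = d * Real.Gamma ((d : ℝ) / 2) /
      (√Real.pi * Real.Gamma (((d : ℝ) - 1) / 2)) *
        ∫ t in (-1 : ℝ)..1, t ^ 2 * Real.exp (κ * t ^ 2) * sphereWeight d t := by
    rw [kummerM, ProbabilityTheory.beta,
      show (d : ℝ) / 2 + 1 - 3 / 2 - 1 = (d - 3) / 2 by ring,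
      show (3 / 2 : ℝ) + ((d : ℝ) / 2 + 1 - 3 / 2) = d / 2 + 1 by ring,
      show (d : ℝ) / 2 + 1 - 3 / 2 = (d - 1) / 2 by ring, Real.Gamma_add_one hd0.ne',
      show (3 / 2 : ℝ) = 1 / 2 + 1 by norm_num, Real.Gamma_add_one (by norm_num),
      Real.Gamma_one_half_eq]
    have hf : ∀ t : ℝ, Real.exp (κ * t ^ 2) * |t| ^ (2 * (1 / 2 + 1) - 1 : ℝ) *
        (1 - t ^ 2) ^ (((d : ℝ) - 3) / 2) = t ^ 2 * Real.exp (κ * t ^ 2) * sphereWeight d t := by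
      intro t
      rw [show (2 * (1 / 2 + 1) - 1 : ℝ) = (2 : ℕ) by norm_num, Real.rpow_natCast, sq_abs,
        sphereWeight]
      ring
    simp only [hf]
    generalize ∫ t in (-1 : ℝ)..1, t ^ 2 * Real.exp (κ * t ^ 2) * sphereWeight d t = J
    field_simp
  have hZ := watsonNorm_eq hd κ θ
  have hZpos := integral_exp_mul_pos (d := d) (by lia) ((continuous_sdot_right θ).fun_pow 2) κ
  have hnum := integral_zonal hd θ (g := fun t => t ^ 2 * Real.exp (κ * t ^ 2)) (by fun_prop)
  rw [hnum]
  rw [← hZ] at hZpos ⊢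
  rw [watsonNorm] at hZpos ⊢
  have hpi : 0 < Real.pi ^ ((d : ℝ) / 2) := by positivity
  have hM0 : 0 < kummerM (1 / 2) ((d : ℝ) / 2) κ :=
    (pos_iff_pos_of_mul_pos hZpos).1 (by positivity)
  rw [watsonD, hM, sphereArea_pred_eq hd]
  have hd1 : (d : ℝ) ≠ 0 := by linarith
  generalize ∫ t in (-1 : ℝ)..1, t ^ 2 * Real.exp (κ * t ^ 2) * sphereWeight d t = J
  field_simp

/-! ### Logarithmic estimates and the Legendre alternative -/

/-- Second order mean value form of `log (1 + u)`. -/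
theorem exists_sub_log_one_add_eq {u : ℝ} (hu : -1 < u) :
    ∃ v ∈ uIcc 0 u, u - Real.log (1 + u) = u ^ 2 / (2 * (1 + v)) := by
  have hder : ∀ x : ℝ, -1 < x → HasDerivAt (fun y => y - Real.log (1 + y)) (1 - 1 / (1 + x)) x := by
    intro x hx
    have h1 : HasDerivAt (fun y : ℝ => 1 + y) 1 x := (hasDerivAt_id x).const_add 1
    exact (hasDerivAt_id x).sub (h1.log (by linarith))
  have hsq : ∀ x : ℝ, HasDerivAt (fun y : ℝ => y ^ 2) (2 * x) x := fun x => by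
    simpa using hasDerivAt_pow 2 x
  -- Cauchy's mean value theorem against `y²`: the ratio of the derivatives at `v` is
  -- `(v/(1+v))/(2v)`, and `v ≠ 0` cancels.
  rcases lt_trichotomy u 0 with h | h | h
  · obtain ⟨v, hv, hv2⟩ := exists_ratio_hasDerivAt_eq_ratio_slope
      (fun y => y - Real.log (1 + y)) (fun x => 1 - 1 / (1 + x)) h
      (fun x hx => (hder x (by linarith [hx.1])).continuousAt.continuousWithinAt)
      (fun x hx => hder x (by linarith [hx.1])) (fun y => y ^ 2) (fun x => 2 * x)
      (fun x _ => (hsq x).continuousAt.continuousWithinAt) (fun x _ => hsq x)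
    refine ⟨v, by rw [uIcc_of_ge h.le]; exact Ioo_subset_Icc_self hv, ?_⟩
    have hv1 : 0 < 1 + v := by linarith [hv.1]
    have hv0 : v ≠ 0 := hv.2.ne
    norm_num at hv2
    field_simp at hv2 ⊢
    apply mul_left_cancel₀ hv0
    linear_combination hv2
  · subst h
    exact ⟨0, by simp, by simp⟩
  · obtain ⟨v, hv, hv2⟩ := exists_ratio_hasDerivAt_eq_ratio_slope
      (fun y => y - Real.log (1 + y)) (fun x => 1 - 1 / (1 + x)) h
      (fun x hx => (hder x (by linarith [hx.1])).continuousAt.continuousWithinAt)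
      (fun x hx => hder x (by linarith [hx.1])) (fun y => y ^ 2) (fun x => 2 * x)
      (fun x _ => (hsq x).continuousAt.continuousWithinAt) (fun x _ => hsq x)
    refine ⟨v, by rw [uIcc_of_le h.le]; exact Ioo_subset_Icc_self hv, ?_⟩
    have hv1 : 0 < 1 + v := by linarith [hv.1]
    have hv0 : v ≠ 0 := hv.1.ne'
    norm_num at hv2
    field_simp at hv2 ⊢
    apply mul_left_cancel₀ hv0
    linear_combination -hv2

theorem abs_le_of_mem_uIcc_zero {u v : ℝ} (h : v ∈ uIcc 0 u) : |v| ≤ |u| := by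
  have := abs_sub_left_of_mem_uIcc h
  simpa using this

theorem abs_one_add_mul_log_sub_le {u : ℝ} (hu : |u| ≤ 1 / 2) :
    |(1 + u) * Real.log (1 + u) - u - u ^ 2 / 2| ≤ |u| ^ 3 := by
  have hu' := abs_le.1 hu
  obtain ⟨v, hv, h⟩ := exists_sub_log_one_add_eq (u := u) (by linarith)
  have hvu := abs_le_of_mem_uIcc_zero hv
  have hv1 := abs_le.1 (hvu.trans hu)
  have hpos : 1 / 2 ≤ 1 + v := by linarith
  have hlog : Real.log (1 + u) = u - u ^ 2 / (2 * (1 + v)) := by linarith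
  have he : (1 + u) * Real.log (1 + u) - u - u ^ 2 / 2 = u ^ 2 / 2 * ((v - u) / (1 + v)) := by
    rw [hlog]
    have : 1 + v ≠ 0 := by linarith
    field_simp
    ring
  have hvu2 : |v - u| ≤ |u| := by
    have := abs_sub_right_of_mem_uIcc hv
    rw [sub_zero] at this
    rwa [abs_sub_comm]
  rw [he, abs_mul, abs_of_nonneg (by positivity : 0 ≤ u ^ 2 / 2), abs_div,
    abs_of_pos (by linarith : 0 < 1 + v), ← sq_abs u]
  have h3 : |v - u| / (1 + v) ≤ 2 * |u| := by
    rw [div_le_iff₀ (by linarith)]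
    nlinarith [abs_nonneg u]
  calc |u| ^ 2 / 2 * (|v - u| / (1 + v)) ≤ |u| ^ 2 / 2 * (2 * |u|) :=
        mul_le_mul_of_nonneg_left h3 (by positivity)
    _ = |u| ^ 3 := by ring

/-- The mean value form gives `u - log(1+u) = u²/(2(1+v))` with `|v| ≤ κ`, and `(1-κ)² ≤ 1-κ ≤ 1+v ≤
(1+κ)²`. The squares match the shape `(1+ξ)²` wanted later. The factor `1+u` makes the case `u = -1`
trivial. -/
theorem one_add_mul_sub_log_bounds {u κ : ℝ} (hκ1 : κ ≤ 1) (hu : |u| ≤ κ) :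
    (1 - κ) ^ 2 * (2 * ((1 + u) * (u - Real.log (1 + u)))) ≤ (1 + u) * u ^ 2 ∧
      (1 + u) * u ^ 2 ≤ (1 + κ) ^ 2 * (2 * ((1 + u) * (u - Real.log (1 + u)))) := by
  have hκ0 : 0 ≤ κ := (abs_nonneg u).trans hu
  have hu' := abs_le.1 hu
  rcases eq_or_lt_of_le (show -1 ≤ u by linarith) with h | h
  · subst h
    norm_num
  · obtain ⟨v, hv, hlog⟩ := exists_sub_log_one_add_eq h
    have hv1 := abs_le.1 ((abs_le_of_mem_uIcc_zero hv).trans hu)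
    have hvpos : 0 < 1 + v := by
      rcases le_total 0 u with h0 | h0
      · rw [uIcc_of_le h0] at hv
        linarith [hv.1]
      · rw [uIcc_of_ge h0] at hv
        linarith [hv.1]
    have h1 : (1 - κ) ^ 2 ≤ 1 + v := by nlinarith
    have h2 : 1 + v ≤ (1 + κ) ^ 2 := by nlinarith
    have hw : 0 ≤ (1 + u) * u ^ 2 := mul_nonneg (by linarith) (sq_nonneg u)
    rw [hlog]
    have he : ∀ c : ℝ, c * (2 * ((1 + u) * (u ^ 2 / (2 * (1 + v))))) =
        (1 + u) * u ^ 2 * (c / (1 + v)) := by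
      intro c
      field_simp
    rw [he, he]
    exact ⟨mul_le_of_le_one_right hw ((div_le_one hvpos).2 h1),
      le_mul_of_one_le_right hw ((one_le_div hvpos).2 h2)⟩

theorem lpDensity_nonneg {d : ℕ} (hd : 2 ≤ d) (m : ℕ) (θ : USphere d) {κ : ℝ}
    (hκ : κ ∈ Icc (0 : ℝ) 1) (x : USphere d) : 0 ≤ lpDensity m θ κ x := by
  have hS := sphereArea_pos (d := d) (by lia)
  have h := abs_le.1 (abs_legendreP_sdot_le_one hd m θ x)
  rw [lpDensity]
  refine mul_nonneg (by positivity) ?_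
  nlinarith [hκ.1, hκ.2, h.1]

theorem continuous_lpDensity {d : ℕ} (m : ℕ) (θ : USphere d) (κ : ℝ) :
    Continuous (lpDensity m θ κ) := by
  have := continuous_legendreP_sdot m θ
  unfold lpDensity
  fun_prop

theorem integral_const_surfaceMeasure {d : ℕ} (c : ℝ) :
    ∫ _x, c ∂(surfaceMeasure d) = c * sphereArea d := by
  rw [integral_const, smul_eq_mul, mul_comm]
  rfl

theorem integral_lpDensity {d : ℕ} (hd : 2 ≤ d) {m : ℕ} (hm : m ≠ 0) (θ : USphere d) (κ : ℝ) :
    ∫ x, lpDensity m θ κ x ∂(surfaceMeasure d) = 1 := by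
  have hS := sphereArea_pos (d := d) (by lia)
  simp only [lpDensity]
  rw [integral_const_mul, integral_add (integrable_const _)
    ((integrable_surfaceMeasure (continuous_legendreP_sdot m θ)).const_mul κ),
    integral_const_mul, integral_legendreP hd hm, integral_const_surfaceMeasure]
  field_simp
  simp

theorem integral_sdot_pow_eq_psi {d : ℕ} (hd : 2 ≤ d) (β : ℕ) (b : USphere d) :
    ∫ x, sdot b x ^ β ∂(surfaceMeasure d) = sphereArea d * psi d β := by
  have hS := sphereArea_pos (d := d) (by lia)
  rw [integral_sdot_pow (by lia), psi_eq (by lia)]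
  field_simp

theorem gammaFun_lpDensity {d : ℕ} (hd : 2 ≤ d) (β m : ℕ) (θ : USphere d) {κ : ℝ}
    (hκ : κ ∈ Icc (0 : ℝ) 1) (b : USphere d) :
    gammaFun β (lpDensity m θ κ) b =
      κ * (legendreCoeff d β m / harmonicDim d m) * legendreP d m (sdot θ b) := by
  have hS := sphereArea_pos (d := d) (by lia)
  rw [gammaFun_eq β (continuous_lpDensity m θ κ) (lpDensity_nonneg hd m θ hκ)]
  have h : ∀ x, lpDensity m θ κ x * sdot b x ^ β = 1 / sphereArea d * sdot b x ^ β +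
      κ / sphereArea d * (sdot b x ^ β * legendreP d m (sdot θ x)) := by
    intro x
    rw [lpDensity]
    ring
  simp only [h]
  rw [integral_add
    ((integrable_surfaceMeasure ((continuous_sdot_right b).fun_pow β)).const_mul _)
    ((integrable_surfaceMeasure (((continuous_sdot_right b).fun_pow β).fun_mul
      (continuous_legendreP_sdot m θ))).const_mul _), integral_const_mul, integral_const_mul,
    integral_sdot_pow_mul_legendreP hd, integral_sdot_pow_eq_psi hd, sdot_comm θ b]
  field_simp
  ring

/-- With `u = κ P_m`, write `(1+u) log(1+u) = u + u² - G`, where `G = (1+u)(u - log(1+u))`.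
Integrating the pointwise bounds places `∫W / (2∫G)`, for `W = (1+u)u²`, between `(1-κ)²` and
`(1+κ)²`, so its square root is `1 + ξ` with `|ξ| ≤ κ`. The integral of `W` supplies the quadratic
and cubic terms. -/
theorem exists_klNull_lpDensity {d : ℕ} (hd : 2 ≤ d) {m : ℕ} (hm : m ≠ 0) (θ : USphere d) {κ : ℝ}
    (hκ : κ ∈ Icc (0 : ℝ) 1) :
    ∃ ξ : ℝ, |ξ| ≤ κ ∧ -1 < ξ ∧
      klNull (lpDensity m θ κ)
        = κ ^ 2 / harmonicDim d m * (1 - 1 / (2 * (1 + ξ) ^ 2))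
          - κ ^ 3 / (2 * (1 + ξ) ^ 2) * (sphereArea (d - 1) / sphereArea d) *
              ∫ t in (-1 : ℝ)..1, legendreP d m t ^ 3 * sphereWeight d t := by
  obtain ⟨hκ0, hκ1⟩ := hκ
  have hS := sphereArea_pos (d := d) (by lia)
  have hP := continuous_legendreP_sdot m θ
  let u : USphere d → ℝ := fun x => κ * legendreP d m (sdot θ x)
  have huc : Continuous u := continuous_const.mul hP
  have hu : ∀ x, |u x| ≤ κ := fun x => by
    simp only [u]
    rw [abs_mul, abs_of_nonneg hκ0]
    exact mul_le_of_le_one_right hκ0 (abs_legendreP_sdot_le_one hd m θ x)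
  let W : USphere d → ℝ := fun x => (1 + u x) * u x ^ 2
  let G : USphere d → ℝ := fun x => (1 + u x) * (u x - Real.log (1 + u x))
  have hb := fun x => one_add_mul_sub_log_bounds hκ1 (hu x)
  have hWc : Continuous W := by fun_prop
  -- Continuity of `y log y` at `0` covers points with `u = -1`, which may occur for `κ = 1`.
  have hLc : Continuous fun x => (1 + u x) * Real.log (1 + u x) :=
    Real.continuous_mul_log.comp (continuous_const.add huc)
  have hGc : Continuous G := by
    have : G = fun x => (1 + u x) * u x - (1 + u x) * Real.log (1 + u x) := by
      funext x
      simp only [G]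
      ring
    rw [this]
    fun_prop
  have hW0 : ∀ x, 0 ≤ W x := fun x =>
    mul_nonneg (by linarith [(abs_le.1 (hu x)).1]) (sq_nonneg _)
  set IW := ∫ x, W x ∂(surfaceMeasure d) with hIW
  set IG := ∫ x, G x ∂(surfaceMeasure d) with hIG
  have hG0 : ∀ x, 0 ≤ G x := fun x => by
    have h1 := (hW0 x).trans (hb x).2
    have h2 : (0 : ℝ) < (1 + κ) ^ 2 := by positivity
    have h3 := (mul_nonneg_iff_of_pos_left h2).1 h1
    linarith
  have hIW0 : 0 ≤ IW := integral_nonneg hW0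
  have hIG0 : 0 ≤ IG := integral_nonneg hG0
  have hWi := integrable_surfaceMeasure hWc
  have hGi := integrable_surfaceMeasure hGc
  have hlow : (1 - κ) ^ 2 * (2 * IG) ≤ IW := by
    rw [hIG, ← integral_const_mul, ← integral_const_mul]
    exact integral_mono ((hGi.const_mul _).const_mul _) hWi fun x => (hb x).1
  have hup : IW ≤ (1 + κ) ^ 2 * (2 * IG) := by
    rw [hIG, ← integral_const_mul, ← integral_const_mul]
    exact integral_mono hWi ((hGi.const_mul _).const_mul _) fun x => (hb x).2
  -- For `κ = 1` the lower bound is void. This implication still yields a positive quotient, hence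
  -- `ξ > -1`.
  have hWG : IW = 0 → IG = 0 := by
    intro h
    rw [hIW, integral_eq_zero_iff_of_nonneg hW0 hWi] at h
    rw [hIG]
    refine integral_eq_zero_of_ae (h.mono fun x hx => ?_)
    simp only [W, G, Pi.zero_apply, mul_eq_zero] at hx ⊢
    rcases hx with hx | hx
    · exact Or.inl hx
    · right
      rw [pow_eq_zero_iff two_ne_zero] at hx
      simp [hx]
  obtain ⟨ξ, hξκ, hξ1, hξ⟩ : ∃ ξ : ℝ, |ξ| ≤ κ ∧ -1 < ξ ∧ IG = IW / (2 * (1 + ξ) ^ 2) := by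
    rcases hIG0.eq_or_lt with h | h
    -- Degenerate case, for instance `κ = 0`: both integrals vanish and any admissible `ξ` would do.
    · refine ⟨0, by simpa using hκ0, by norm_num, ?_⟩
      have : IW = 0 := by
        rw [← h] at hup
        linarith
      rw [this, ← h]
      simp
    · have hIWpos : 0 < IW := lt_of_le_of_ne hIW0 fun h0 => h.ne' (hWG h0.symm)
      have hq : 0 < IW / (2 * IG) := by positivity
      refine ⟨√(IW / (2 * IG)) - 1, ?_, by linarith [Real.sqrt_pos.2 hq], ?_⟩
      · have h1 : √(IW / (2 * IG)) ≤ 1 + κ := by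
          rw [Real.sqrt_le_left (by linarith), div_le_iff₀ (by positivity)]
          exact hup
        have h2 : 1 - κ ≤ √(IW / (2 * IG)) := by
          apply Real.le_sqrt_of_sq_le
          rw [le_div_iff₀ (by positivity)]
          exact hlow
        rw [abs_le]
        constructor <;> linarith
      · rw [add_sub_cancel, Real.sq_sqrt hq.le]
        field_simp
  refine ⟨ξ, hξκ, hξ1, ?_⟩
  have hQ : ∫ x, legendreP d m (sdot θ x) ^ 3 ∂(surfaceMeasure d) = sphereArea (d - 1) *
      ∫ t in (-1 : ℝ)..1, legendreP d m t ^ 3 * sphereWeight d t :=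
    integral_zonal hd θ (g := fun t => legendreP d m t ^ 3) ((continuous_legendreP d m).pow 3)
  have hu2 : ∫ x, u x ^ 2 ∂(surfaceMeasure d) = κ ^ 2 * (sphereArea d / harmonicDim d m) := by
    rw [← integral_legendreP_sq hd m θ, ← integral_const_mul]
    congr 1
    funext x
    simp only [u]
    ring
  have hu3 : ∫ x, u x ^ 3 ∂(surfaceMeasure d) = κ ^ 3 * (sphereArea (d - 1) *
      ∫ t in (-1 : ℝ)..1, legendreP d m t ^ 3 * sphereWeight d t) := by
    rw [← hQ, ← integral_const_mul]
    congr 1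
    funext x
    simp only [u]
    ring
  have hu1 : ∫ x, u x ∂(surfaceMeasure d) = 0 := by
    simp only [u]
    rw [integral_const_mul, integral_legendreP hd hm, mul_zero]
  have hIWe : IW = κ ^ 2 * (sphereArea d / harmonicDim d m) + κ ^ 3 * (sphereArea (d - 1) *
      ∫ t in (-1 : ℝ)..1, legendreP d m t ^ 3 * sphereWeight d t) := by
    rw [← hu2, ← hu3, ← integral_add (integrable_surfaceMeasure (by fun_prop))
      (integrable_surfaceMeasure (by fun_prop)), hIW]
    congr 1
    funext x
    simp only [W]
    ring
  have hkl : klNull (lpDensity m θ κ) =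
      1 / sphereArea d * (κ ^ 2 * (sphereArea d / harmonicDim d m) - IG) := by
    rw [klNull_eq (continuous_lpDensity m θ κ) (lpDensity_nonneg hd m θ ⟨hκ0, hκ1⟩)]
    have h : ∀ x, lpDensity m θ κ x * Real.log (sphereArea d * lpDensity m θ κ x) =
        1 / sphereArea d * (u x + u x ^ 2 - G x) := by
      intro x
      have h1 : sphereArea d * lpDensity m θ κ x = 1 + u x := by
        rw [lpDensity]
        field_simp
        rfl
      rw [h1, show lpDensity m θ κ x = 1 / sphereArea d * (1 + u x) from rfl]
      simp only [G]
      ring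
    simp only [h]
    rw [integral_const_mul, integral_sub (integrable_surfaceMeasure (by fun_prop)) hGi,
      integral_add (integrable_surfaceMeasure huc) (integrable_surfaceMeasure (by fun_prop)),
      hu1, hu2, zero_add]
  rw [hkl, hξ, hIWe]
  have hξ2 : 1 + ξ ≠ 0 := by linarith
  have hν := harmonicDim_pos hd m
  generalize ∫ t in (-1 : ℝ)..1, legendreP d m t ^ 3 * sphereWeight d t = J
  field_simp
  ring

/-! ### Local efficiency -/

theorem integral_sub_sub {d : ℕ} {f g h : USphere d → ℝ} (hf : Integrable f (surfaceMeasure d))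
    (hg : Integrable g (surfaceMeasure d)) (hh : Integrable h (surfaceMeasure d)) :
    ∫ x, (f x - g x - h x) ∂(surfaceMeasure d) = ∫ x, f x ∂(surfaceMeasure d) -
      ∫ x, g x ∂(surfaceMeasure d) - ∫ x, h x ∂(surfaceMeasure d) := by
  rw [← integral_sub hf hg]
  exact integral_sub (hf.sub hg) hh

theorem tendsto_div_sq_of_abs_sub_le {F : ℝ → ℝ} {L M : ℝ}
    (h : ∀ᶠ κ in 𝓝[>] (0 : ℝ), |F κ - κ ^ 2 * L| ≤ M * κ ^ 3) :
    Tendsto (fun κ => F κ / κ ^ 2) (𝓝[>] 0) (𝓝 L) := by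
  rw [tendsto_iff_norm_sub_tendsto_zero]
  have hM : Tendsto (fun κ : ℝ => M * κ) (𝓝[>] 0) (𝓝 0) := by
    have : Tendsto (fun κ : ℝ => M * κ) (𝓝 0) (𝓝 (M * 0)) := tendsto_id.const_mul M
    rw [mul_zero] at this
    exact this.mono_left nhdsWithin_le_nhds
  refine squeeze_zero' (Eventually.of_forall fun _ => norm_nonneg _) ?_ hM
  filter_upwards [h, self_mem_nhdsWithin] with κ hκ hpos
  have hpos' : 0 < κ := hpos
  have he : F κ / κ ^ 2 - L = (F κ - κ ^ 2 * L) / κ ^ 2 := by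
    field_simp
  rw [he, norm_div, Real.norm_eq_abs, Real.norm_eq_abs, abs_of_pos (by positivity : 0 < κ ^ 2),
    div_le_iff₀ (by positivity)]
  calc _ ≤ _ := hκ
    _ = _ := by ring

/-- Asymptotics of the efficiency for a family of densities which to first order is a Legendre
polynomial alternative. -/
theorem tendsto_efficiency {d : ℕ} (hd : 2 ≤ d) (β : ℕ) {m : ℕ} (hm : m ≠ 0) (θ : USphere d)
    {α C : ℝ} (hα : α ≠ 0) {f : ℝ → USphere d → ℝ}
    (hfc : ∀ κ ∈ Ioc (0 : ℝ) 1, Continuous (f κ)) (hf0 : ∀ κ ∈ Ioc (0 : ℝ) 1, ∀ x, 0 ≤ f κ x)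
    (hf1 : ∀ κ ∈ Ioc (0 : ℝ) 1, ∫ x, f κ x ∂(surfaceMeasure d) = 1)
    (hf : ∀ κ ∈ Ioc (0 : ℝ) 1, ∀ x,
      |sphereArea d * f κ x - 1 - κ * (α * legendreP d m (sdot θ x))| ≤ C * κ ^ 2) :
    Tendsto (fun κ : ℝ => maxGammaSq β (f κ) / (2 * klNull (f κ)))
      (𝓝[>] 0) (𝓝 (lambdaEig d β m * harmonicDim d m)) := by
  have hS := sphereArea_pos (d := d) (by lia)
  have hν := harmonicDim_pos hd m
  have hC : 0 ≤ C := by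
    have := (abs_nonneg _).trans (hf 1 ⟨one_pos, le_rfl⟩ θ)
    simpa using this
  -- `κ a` is the leading coefficient of `γ_κ`, and `K κ` will bound `| |S| f - 1 |`.
  set a := α * (legendreCoeff d β m / harmonicDim d m) with ha
  set K := |α| + C with hK
  have hK0 : 0 < K := add_pos_of_pos_of_nonneg (abs_pos.2 hα) hC
  have hP1 := abs_legendreP_sdot_le_one hd m
  have hPc := continuous_legendreP_sdot m θ
  have hu : ∀ κ ∈ Ioc (0 : ℝ) 1, ∀ x, |sphereArea d * f κ x - 1| ≤ K * κ := by
    intro κ hκ x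
    have h1 := hf κ hκ x
    have h2 : |κ * (α * legendreP d m (sdot θ x))| ≤ |α| * κ := by
      rw [abs_mul, abs_mul, abs_of_pos hκ.1]
      nlinarith [hP1 θ x, mul_nonneg hκ.1.le (abs_nonneg α)]
    have h3 : C * κ ^ 2 ≤ C * κ := by nlinarith [hκ.1, hκ.2, mul_nonneg hC hκ.1.le]
    calc |sphereArea d * f κ x - 1|
        = |(sphereArea d * f κ x - 1 - κ * (α * legendreP d m (sdot θ x))) +
            κ * (α * legendreP d m (sdot θ x))| := by ring_nf
      _ ≤ _ := abs_add_le _ _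
      _ ≤ K * κ := by rw [hK]; linarith
  have hev1 : ∀ᶠ κ in 𝓝[>] (0 : ℝ), κ ∈ Ioc (0 : ℝ) 1 :=
    Ioc_mem_nhdsGT one_pos
  have hev2 : ∀ᶠ κ in 𝓝[>] (0 : ℝ), κ ≤ 1 / (2 * K) := by
    have : Ioc (0 : ℝ) (1 / (2 * K)) ∈ 𝓝[>] (0 : ℝ) := Ioc_mem_nhdsGT (by positivity)
    filter_upwards [this] with κ hκ using hκ.2
  have hgam : Tendsto (fun κ => maxGammaSq β (f κ) / κ ^ 2) (𝓝[>] 0) (𝓝 (a ^ 2)) := by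
    apply tendsto_div_sq_of_abs_sub_le (M := 2 * |a| * C + C ^ 2)
    filter_upwards [hev1] with κ hκ
    have hγ : ∀ b, |gammaFun β (f κ) b - κ * a * legendreP d m (sdot b θ)| ≤ C * κ ^ 2 := by
      intro b
      have hbc := (continuous_sdot_right b).fun_pow β
      have he : gammaFun β (f κ) b - κ * a * legendreP d m (sdot b θ) = 1 / sphereArea d *
          ∫ x, (sphereArea d * f κ x - 1 - κ * (α * legendreP d m (sdot θ x))) * sdot b x ^ β
            ∂(surfaceMeasure d) := by
        rw [gammaFun_eq β (hfc κ hκ) (hf0 κ hκ)]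
        have h : ∀ x, (sphereArea d * f κ x - 1 - κ * (α * legendreP d m (sdot θ x))) *
            sdot b x ^ β = sphereArea d * (f κ x * sdot b x ^ β) - sdot b x ^ β -
              κ * α * (sdot b x ^ β * legendreP d m (sdot θ x)) := by
          intro x
          ring
        simp only [h]
        have i1 := (integrable_surfaceMeasure ((hfc κ hκ).fun_mul hbc)).const_mul (sphereArea d)
        have i2 := integrable_surfaceMeasure hbc
        have i3 := (integrable_surfaceMeasure (hbc.fun_mul hPc)).const_mul (κ * α)
        rw [integral_sub_sub i1 i2 i3, integral_const_mul,
          integral_const_mul, integral_sdot_pow_eq_psi hd, integral_sdot_pow_mul_legendreP hd, ha]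
        field_simp
      rw [he, abs_mul, abs_of_pos (by positivity : 0 < 1 / sphereArea d)]
      have h2 := abs_integral_surfaceMeasure_le (d := d) (ε := C * κ ^ 2)
        (g := fun x => (sphereArea d * f κ x - 1 - κ * (α * legendreP d m (sdot θ x))) *
          sdot b x ^ β) fun x => by
            rw [abs_mul, abs_pow]
            refine (mul_le_of_le_one_right (abs_nonneg _) ?_).trans (hf κ hκ x)
            exact pow_le_one₀ (abs_nonneg _) (abs_sdot_le_one b x)
      calc _ ≤ 1 / sphereArea d * (C * κ ^ 2 * sphereArea d) :=
            mul_le_mul_of_nonneg_left h2 (by positivity)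
        _ = C * κ ^ 2 := by field_simp
    have hκ3 : 0 < κ ^ 3 := pow_pos hκ.1 3
    have hκ4 : κ ^ 4 ≤ κ ^ 3 := pow_le_pow_of_le_one hκ.1.le hκ.2 (by norm_num)
    have hmax := isGreatest_maxGammaSq β (hfc κ hκ) (hf0 κ hκ) θ
    have hCκ : 0 ≤ C * κ ^ 2 := by positivity
    -- The upper bound uses `|P_m| ≤ 1`; the lower one below tests `b = θ`, where `P_m = 1`.
    have hup : maxGammaSq β (f κ) ≤ (κ * |a| + C * κ ^ 2) ^ 2 := by
      obtain ⟨b, hb⟩ := hmax.1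
      rw [← hb]
      refine sq_le_sq' ?_ ?_ <;>
      · have h1 := abs_le.1 (hγ b)
        have h2 : |κ * a * legendreP d m (sdot b θ)| ≤ κ * |a| := by
          rw [abs_mul, abs_mul, abs_of_pos hκ.1]
          exact mul_le_of_le_one_right (mul_nonneg hκ.1.le (abs_nonneg _)) (hP1 b θ)
        have h3 := abs_le.1 h2
        linarith [h1.1, h1.2, h3.1, h3.2]
    have hlow : κ ^ 2 * a ^ 2 - 2 * |a| * C * κ ^ 3 ≤ maxGammaSq β (f κ) := by
      refine le_trans ?_ (hmax.2 ⟨θ, rfl⟩)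
      have h1 := hγ θ
      rw [sdot_self, legendreP_one hd, mul_one] at h1
      have h2 : |κ * a * (gammaFun β (f κ) θ - κ * a)| ≤ κ * |a| * (C * κ ^ 2) := by
        rw [abs_mul, abs_mul, abs_of_pos hκ.1]
        exact mul_le_mul_of_nonneg_left h1 (mul_nonneg hκ.1.le (abs_nonneg _))
      nlinarith [(abs_le.1 h2).1, sq_nonneg (gammaFun β (f κ) θ - κ * a)]
    rw [abs_le]
    constructor
    · nlinarith [mul_nonneg (sq_nonneg C) hκ3.le]
    · have hexp : (κ * |a| + C * κ ^ 2) ^ 2 =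
          κ ^ 2 * a ^ 2 + 2 * |a| * C * κ ^ 3 + C ^ 2 * κ ^ 4 := by
        rw [← sq_abs a]
        ring
      nlinarith [mul_le_mul_of_nonneg_left hκ4 (sq_nonneg C)]
  -- With `u = |S| f - 1` one has `2(1+u) log(1+u) = 2u + u² + O(u³)`. The linear term integrates to
  -- zero because `f` is a probability density, and `u²` is `κ²α²P_m²` up to `O(κ³)`.
  have hkl : Tendsto (fun κ => 2 * klNull (f κ) / κ ^ 2) (𝓝[>] 0)
      (𝓝 (α ^ 2 / harmonicDim d m)) := by
    apply tendsto_div_sq_of_abs_sub_le (M := 2 * K ^ 3 + 2 * C * K)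
    filter_upwards [hev1, hev2] with κ hκ hκ2
    let u : USphere d → ℝ := fun x => sphereArea d * f κ x - 1
    have hfκ := hfc κ hκ
    have huc : Continuous u := by fun_prop
    have hKκ : K * κ ≤ 1 / 2 := by
      rw [le_div_iff₀ (by positivity)] at hκ2
      linarith
    have hLc : Continuous fun x => (1 + u x) * Real.log (1 + u x) :=
      Real.continuous_mul_log.comp (continuous_const.add huc)
    have hu1 : ∫ x, u x ∂(surfaceMeasure d) = 0 := by
      simp only [u]
      rw [integral_sub ((integrable_surfaceMeasure hfκ).const_mul _) (integrable_const _),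
        integral_const_mul, hf1 κ hκ, integral_const_surfaceMeasure]
      ring
    have he : 2 * klNull (f κ) - κ ^ 2 * (α ^ 2 / harmonicDim d m) = 1 / sphereArea d *
        ∫ x, (2 * ((1 + u x) * Real.log (1 + u x) - u x - u x ^ 2 / 2) +
          (u x ^ 2 - κ ^ 2 * α ^ 2 * (legendreP d m (sdot θ x) * legendreP d m (sdot θ x))))
          ∂(surfaceMeasure d) := by
      rw [klNull_eq hfκ (hf0 κ hκ)]
      have h1 : ∀ x, f κ x * Real.log (sphereArea d * f κ x) =
          1 / sphereArea d * ((1 + u x) * Real.log (1 + u x)) := by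
        intro x
        simp only [u, add_sub_cancel]
        field_simp
      have h2 : ∀ x, (2 * ((1 + u x) * Real.log (1 + u x) - u x - u x ^ 2 / 2) +
          (u x ^ 2 - κ ^ 2 * α ^ 2 * (legendreP d m (sdot θ x) * legendreP d m (sdot θ x)))) =
          2 * ((1 + u x) * Real.log (1 + u x)) - 2 * u x -
            κ ^ 2 * α ^ 2 * (legendreP d m (sdot θ x) * legendreP d m (sdot θ x)) := by
        intro x
        ring
      simp only [h1, h2]
      have i1 := (integrable_surfaceMeasure hLc).const_mul 2
      have i2 := (integrable_surfaceMeasure huc).const_mul 2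
      have i3 := (integrable_surfaceMeasure (hPc.fun_mul hPc)).const_mul (κ ^ 2 * α ^ 2)
      rw [integral_sub_sub i1 i2 i3, integral_const_mul, integral_const_mul,
        integral_const_mul, integral_const_mul, hu1, integral_legendreP_sq hd]
      field_simp
      ring
    rw [he, abs_mul, abs_of_pos (by positivity : 0 < 1 / sphereArea d)]
    have h3 := abs_integral_surfaceMeasure_le (d := d) (ε := (2 * K ^ 3 + 2 * C * K) * κ ^ 3)
      (g := fun x => (2 * ((1 + u x) * Real.log (1 + u x) - u x - u x ^ 2 / 2) +
          (u x ^ 2 - κ ^ 2 * α ^ 2 * (legendreP d m (sdot θ x) * legendreP d m (sdot θ x)))))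
      fun x => by
        have hux : |u x| ≤ K * κ := hu κ hκ x
        have e1 := (abs_one_add_mul_log_sub_le (hux.trans hKκ)).trans
          (pow_le_pow_left₀ (abs_nonneg _) hux 3)
        have e2 : |u x - κ * (α * legendreP d m (sdot θ x))| ≤ C * κ ^ 2 := hf κ hκ x
        have e3 : |u x + κ * (α * legendreP d m (sdot θ x))| ≤ 2 * K * κ := by
          refine (abs_add_le _ _).trans ?_
          have : |κ * (α * legendreP d m (sdot θ x))| ≤ |α| * κ := by
            rw [abs_mul, abs_mul, abs_of_pos hκ.1]
            nlinarith [hP1 θ x, mul_nonneg hκ.1.le (abs_nonneg α)]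
          nlinarith [mul_nonneg hC hκ.1.le]
        have e4 : |u x ^ 2 - κ ^ 2 * α ^ 2 *
            (legendreP d m (sdot θ x) * legendreP d m (sdot θ x))| ≤
            C * κ ^ 2 * (2 * K * κ) := by
          rw [show u x ^ 2 - κ ^ 2 * α ^ 2 *
            (legendreP d m (sdot θ x) * legendreP d m (sdot θ x)) =
            (u x - κ * (α * legendreP d m (sdot θ x))) *
              (u x + κ * (α * legendreP d m (sdot θ x))) by ring, abs_mul]
          exact mul_le_mul e2 e3 (abs_nonneg _) (by positivity)
        refine (abs_add_le _ _).trans ?_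
        rw [abs_mul, abs_two]
        calc _ ≤ 2 * (K * κ) ^ 3 + C * κ ^ 2 * (2 * K * κ) := by gcongr
          _ = _ := by ring
    calc _ ≤ 1 / sphereArea d * ((2 * K ^ 3 + 2 * C * K) * κ ^ 3 * sphereArea d) :=
          mul_le_mul_of_nonneg_left h3 (by positivity)
      _ = _ := by field_simp
  have hV : α ^ 2 / harmonicDim d m ≠ 0 := by positivity
  have hlim := hgam.div hkl hV
  -- `α` cancels. For `m > β` the coefficient in `a` is zero, in accordance with the other branch of
  -- `lambdaEig`.
  have hval : a ^ 2 / (α ^ 2 / harmonicDim d m) = lambdaEig d β m * harmonicDim d m := by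
    rw [lambdaEig]
    split_ifs with h
    · rw [ha]
      field_simp
    · rw [ha, (isLegendreExpansion_legendreCoeff hd β).2 m (by lia)]
      simp
  rw [hval] at hlim
  refine hlim.congr' ?_
  filter_upwards [self_mem_nhdsWithin] with κ hκ
  have hκ' : 0 < κ := hκ
  simp only [Pi.div_apply]
  rw [div_div_div_cancel_right₀ (by positivity)]

/-- Both `exp(κT)` and the normalised constant `z = Z/|S|` equal their linear parts up to `κ²`. Over
the common denominator `z` the remainder is at most `(1 + 2 + 3) κ²`, and `z ≥ 1/3` because `e < 3`;
hence the constant `18`. -/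
theorem abs_tiltDensity_sub_le {d : ℕ} (hd : 1 ≤ d) {T : USphere d → ℝ} (hT : Continuous T)
    (hT1 : ∀ x, |T x| ≤ 1) {μ : ℝ} (hμ : ∫ x, T x ∂(surfaceMeasure d) = sphereArea d * μ)
    {κ : ℝ} (hκ : κ ∈ Ioc (0 : ℝ) 1) (x : USphere d) :
    |sphereArea d * tiltDensity T κ x - 1 - κ * (T x - μ)| ≤ 18 * κ ^ 2 := by
  have hS := sphereArea_pos hd
  obtain ⟨hκ0, hκ1⟩ := hκ
  have hκT : ∀ x, |κ * T x| ≤ κ := fun x => by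
    rw [abs_mul, abs_of_pos hκ0]
    exact mul_le_of_le_one_right hκ0.le (hT1 x)
  have hexp : ∀ x, |Real.exp (κ * T x) - 1 - κ * T x| ≤ κ ^ 2 := fun x =>
    (Real.abs_exp_sub_one_sub_id_le ((hκT x).trans hκ1)).trans
      (sq_le_sq' (by linarith [(abs_le.1 (hκT x)).1]) (abs_le.1 (hκT x)).2)
  set Z := ∫ y, Real.exp (κ * T y) ∂(surfaceMeasure d) with hZ
  have hec : Continuous fun y => Real.exp (κ * T y) := by fun_prop
  have hZ1 : |Z / sphereArea d - 1 - κ * μ| ≤ κ ^ 2 := by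
    have h1 := abs_integral_surfaceMeasure_le hexp
    have i1 := integrable_surfaceMeasure hec
    have i2 : Integrable (fun _ : USphere d => (1 : ℝ)) (surfaceMeasure d) := integrable_const _
    have i3 := (integrable_surfaceMeasure hT).const_mul κ
    rw [integral_sub_sub i1 i2 i3, integral_const_mul, hμ,
      integral_const_surfaceMeasure] at h1
    have h2 : Z / sphereArea d - 1 - κ * μ =
        (Z - 1 * sphereArea d - κ * (sphereArea d * μ)) / sphereArea d := by
      field_simp
    rw [h2, abs_div, abs_of_pos hS, div_le_iff₀ hS]
    exact h1
  have hμ1 : |μ| ≤ 1 := by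
    have h1 := abs_integral_surfaceMeasure_le hT1
    rw [hμ, abs_mul, abs_of_pos hS, mul_comm] at h1
    exact le_of_mul_le_mul_right h1 hS
  have hZ3 : 1 / 3 ≤ Z / sphereArea d := by
    have h1 : ∫ _y, (1 / 3 : ℝ) ∂(surfaceMeasure d) ≤ Z := by
      refine integral_mono (integrable_const _) (integrable_surfaceMeasure hec) fun y => ?_
      have h2 : Real.exp (-1) ≤ Real.exp (κ * T y) :=
        Real.exp_le_exp.2 (by linarith [(abs_le.1 (hκT y)).1])
      refine le_trans ?_ h2
      rw [Real.exp_neg, one_div]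
      exact inv_anti₀ (Real.exp_pos 1) (by linarith [Real.exp_one_lt_d9])
    rw [integral_const_surfaceMeasure] at h1
    rwa [le_div_iff₀ hS]
  set z := Z / sphereArea d with hz
  have hz0 : 0 < z := by linarith
  have ht : sphereArea d * tiltDensity T κ x = Real.exp (κ * T x) / z := by
    rw [tiltDensity, ← hZ, hz]
    field_simp
  rw [ht]
  obtain ⟨r, hr⟩ : ∃ r, r = Real.exp (κ * T x) - 1 - κ * T x := ⟨_, rfl⟩
  obtain ⟨ρ, hρ⟩ : ∃ ρ, ρ = z - 1 - κ * μ := ⟨_, rfl⟩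
  have hr1 := hexp x
  rw [← hr] at hr1
  rw [← hρ] at hZ1
  have he : Real.exp (κ * T x) / z - 1 - κ * (T x - μ) =
      (r - κ ^ 2 * ((T x - μ) * μ) - ρ * (1 + κ * (T x - μ))) / z := by
    rw [eq_div_iff hz0.ne', hr]
    field_simp
    rw [hρ]
    ring
  have hTμ : |T x - μ| ≤ 2 := (abs_sub _ _).trans (by linarith [hT1 x])
  have hnum : |r - κ ^ 2 * ((T x - μ) * μ) - ρ * (1 + κ * (T x - μ))| ≤ 6 * κ ^ 2 := by
    have h1 : |κ ^ 2 * ((T x - μ) * μ)| ≤ κ ^ 2 * 2 := by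
      rw [abs_mul, abs_mul, abs_of_nonneg (sq_nonneg κ)]
      refine mul_le_mul_of_nonneg_left ?_ (sq_nonneg κ)
      nlinarith [abs_nonneg μ, abs_nonneg (T x - μ)]
    have h2 : |1 + κ * (T x - μ)| ≤ 3 := by
      refine (abs_add_le _ _).trans ?_
      rw [abs_one, abs_mul, abs_of_pos hκ0]
      nlinarith [abs_nonneg (T x - μ)]
    have h3 : |ρ * (1 + κ * (T x - μ))| ≤ κ ^ 2 * 3 := by
      rw [abs_mul]
      exact mul_le_mul hZ1 h2 (abs_nonneg _) (sq_nonneg κ)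
    refine (abs_sub _ _).trans ?_
    refine (add_le_add (abs_sub _ _) le_rfl).trans ?_
    linarith
  rw [he, abs_div, abs_of_pos hz0, div_le_iff₀ hz0]
  nlinarith [sq_nonneg κ]

/-- The constant part `μ` of `T` is absorbed by the normalisation, so to first order only the
component of order `m` is felt. -/
theorem tendsto_efficiency_tiltDensity {d : ℕ} (hd : 2 ≤ d) (β : ℕ) {m : ℕ} (hm : m ≠ 0)
    (θ : USphere d) {T : USphere d → ℝ} (hT : Continuous T) (hT1 : ∀ x, |T x| ≤ 1) {α μ : ℝ}
    (hα : α ≠ 0) (hTP : ∀ x, T x = μ + α * legendreP d m (sdot θ x)) :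
    Tendsto (fun κ : ℝ => maxGammaSq β (tiltDensity T κ) / (2 * klNull (tiltDensity T κ)))
      (𝓝[>] 0) (𝓝 (lambdaEig d β m * harmonicDim d m)) := by
  have hμ : ∫ x, T x ∂(surfaceMeasure d) = sphereArea d * μ := by
    simp only [hTP]
    rw [integral_add (integrable_const _)
      ((integrable_surfaceMeasure (continuous_legendreP_sdot m θ)).const_mul α),
      integral_const_mul, integral_legendreP hd hm, integral_const_surfaceMeasure]
    ring
  refine tendsto_efficiency hd β hm θ (C := 18) hα (fun κ _ => continuous_tiltDensity hT κ)
    (fun κ _ => tiltDensity_nonneg T κ) (fun κ _ => integral_tiltDensity (by lia) hT κ)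
    fun κ hκ x => ?_
  have h := abs_tiltDensity_sub_le (by lia) hT hT1 hμ hκ x
  rwa [show T x - μ = α * legendreP d m (sdot θ x) by rw [hTP]; ring] at h

/-! ### Orders one and two, and the assembly -/

theorem legendreP_one_order {d : ℕ} (hd : 2 ≤ d) (t : ℝ) : legendreP d 1 t = t := by
  have h := (Gamma_half_pred_pos hd 0).ne'
  simp only [Nat.cast_zero, zero_add] at h
  simp only [legendreP, Nat.reduceDiv, zero_add, Finset.sum_range_one]
  simp
  field_simp

theorem legendreP_two_order {d : ℕ} (hd : 2 ≤ d) (t : ℝ) :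
    t ^ 2 = 1 / d + ((d : ℝ) - 1) / d * legendreP d 2 t := by
  have ha := half_pred_pos hd
  have h := Real.Gamma_pos_of_pos ha
  have h1 : 0 < (d : ℝ) - 1 := by linarith
  have hd0 : (d : ℝ) ≠ 0 := by linarith
  simp only [legendreP, Nat.reduceDiv, Nat.reduceAdd, Finset.sum_range_succ, Finset.sum_range_zero]
  norm_num
  rw [add_comm (1 : ℝ) _, Real.Gamma_add_one ha.ne']
  field_simp
  ring

end

theorem mainTheorem8 (d β : ℕ) (hd : 2 ≤ d) (hβ : 1 ≤ β) (θ : USphere d) :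
    -- von Mises–Fisher alternatives
    ((∀ κ : ℝ, 0 < κ →
        klNull (vmfDensity θ κ)
          = vmfA d κ * κ - Real.log (vmfNorm d κ) + Real.log (sphereArea d) ∧
        (∀ b : USphere d,
          Summable (fun l : ℕ => κ ^ l / (l.factorial : ℝ) *
            ∑ j ∈ Finset.range (β + 1),
              legendreCoeff d β j * legendreDelta d j l * legendreP d j (sdot θ b)) ∧
          gammaFun β (vmfDensity θ κ) b
            = sphereArea (d - 1) / vmfNorm d κ *
                (∑' l : ℕ, κ ^ l / (l.factorial : ℝ) *
                  ∑ j ∈ Finset.range (β + 1),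
                    legendreCoeff d β j * legendreDelta d j l * legendreP d j (sdot θ b))
              - psi d β) ∧
        IsGreatest (range fun b : USphere d => gammaFun β (vmfDensity θ κ) b ^ 2)
          (maxGammaSq β (vmfDensity θ κ))) ∧
      Tendsto (fun κ : ℝ => maxGammaSq β (vmfDensity θ κ) / (2 * klNull (vmfDensity θ κ)))
        (𝓝[>] 0) (𝓝 (lambdaEig d β 1 * harmonicDim d 1))) ∧
    -- Watson alternatives
    ((∀ κ : ℝ, 0 < κ →
        klNull (watsonDensity θ κ)
          = watsonD d κ * κ - Real.log (watsonNorm d κ) + Real.log (sphereArea d) ∧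
        (∀ b : USphere d,
          Summable (fun l : ℕ => κ ^ l / (l.factorial : ℝ) *
            ∑ j ∈ Finset.range (β + 1),
              legendreCoeff d β j * legendreDelta d j (2 * l) * legendreP d j (sdot θ b)) ∧
          gammaFun β (watsonDensity θ κ) b
            = sphereArea (d - 1) / watsonNorm d κ *
                (∑' l : ℕ, κ ^ l / (l.factorial : ℝ) *
                  ∑ j ∈ Finset.range (β + 1),
                    legendreCoeff d β j * legendreDelta d j (2 * l) * legendreP d j (sdot θ b))
              - psi d β) ∧
        IsGreatest (range fun b : USphere d => gammaFun β (watsonDensity θ κ) b ^ 2)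
          (maxGammaSq β (watsonDensity θ κ))) ∧
      Tendsto (fun κ : ℝ => maxGammaSq β (watsonDensity θ κ) / (2 * klNull (watsonDensity θ κ)))
        (𝓝[>] 0) (𝓝 (lambdaEig d β 2 * harmonicDim d 2))) ∧
    -- Legendre polynomial alternatives of order `m`
    (∀ m : ℕ, 1 ≤ m →
      (∀ κ ∈ Icc (0 : ℝ) 1,
        (∃ ξ : ℝ, |ξ| ≤ κ ∧ -1 < ξ ∧
          klNull (lpDensity m θ κ)
            = κ ^ 2 / harmonicDim d m * (1 - 1 / (2 * (1 + ξ) ^ 2))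
              - κ ^ 3 / (2 * (1 + ξ) ^ 2) * (sphereArea (d - 1) / sphereArea d) *
                  ∫ t in (-1 : ℝ)..1, legendreP d m t ^ 3 * sphereWeight d t) ∧
        (∀ b : USphere d,
          gammaFun β (lpDensity m θ κ) b
            = κ * (legendreCoeff d β m / harmonicDim d m) * legendreP d m (sdot θ b)) ∧
        IsGreatest (range fun b : USphere d => gammaFun β (lpDensity m θ κ) b ^ 2)
          (maxGammaSq β (lpDensity m θ κ))) ∧
      Tendsto (fun κ : ℝ => maxGammaSq β (lpDensity m θ κ) / (2 * klNull (lpDensity m θ κ)))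
        (𝓝[>] 0) (𝓝 (lambdaEig d β m * harmonicDim d m))) := by
  have hS' : 0 < sphereArea (d - 1) := sphereArea_pos (by lia)
  have hd' : (2 : ℝ) ≤ d := by exact_mod_cast hd
  have hc1 := continuous_sdot_right θ
  have hc2 := hc1.fun_pow 2
  have hb1 : ∀ x : USphere d, |sdot θ x| ≤ 1 := abs_sdot_le_one θ
  have hb2 : ∀ x : USphere d, |sdot θ x ^ 2| ≤ 1 := fun x => by
    rw [abs_pow]
    exact pow_le_one₀ (abs_nonneg _) (hb1 x)
  refine ⟨⟨fun κ hκ => ?_, ?_⟩, ⟨fun κ hκ => ?_, ?_⟩, fun m hm => ⟨fun κ hκ => ?_, ?_⟩⟩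
  · rw [vmfDensity_eq hd hκ, vmfA_eq hd hκ θ, vmfNorm_eq hd hκ θ]
    exact ⟨klNull_tiltDensity (by lia) hc1 κ,
      fun b => hasSum_gammaFun_tiltDensity β hc1 hb1 hκ.le b hS'
        fun l => integral_sdot_pow_mul_sdot_pow hd β l b θ,
      isGreatest_maxGammaSq β (continuous_tiltDensity hc1 κ) (tiltDensity_nonneg _ κ) θ⟩
  -- The Bessel form is identified with the tilt only for `κ > 0`, so the limit is transferred by
  -- eventual equality.
  · refine (tendsto_efficiency_tiltDensity hd β one_ne_zero θ hc1 hb1 (α := 1) (μ := 0)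
      one_ne_zero fun x => by rw [legendreP_one_order hd]; ring).congr' ?_
    filter_upwards [self_mem_nhdsWithin] with κ hκ
    rw [vmfDensity_eq hd hκ]
  · rw [watsonDensity_eq hd, watsonD_eq hd κ θ, watsonNorm_eq hd κ θ]
    refine ⟨klNull_tiltDensity (by lia) hc2 κ,
      fun b => hasSum_gammaFun_tiltDensity β hc2 hb2 hκ.le b hS' fun l => ?_,
      isGreatest_maxGammaSq β (continuous_tiltDensity hc2 κ) (tiltDensity_nonneg _ κ) θ⟩
    simp only [← pow_mul]
    exact integral_sdot_pow_mul_sdot_pow hd β (2 * l) b θ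
  · simp only [watsonDensity_eq hd]
    exact tendsto_efficiency_tiltDensity hd β two_ne_zero θ hc2 hb2
      (div_ne_zero (by linarith) (by linarith)) fun x => legendreP_two_order hd _
  · exact ⟨exists_klNull_lpDensity hd (by lia) θ hκ, gammaFun_lpDensity hd β m θ hκ,
      isGreatest_maxGammaSq β (continuous_lpDensity m θ κ) (lpDensity_nonneg hd m θ hκ) θ⟩
  · have hS : 0 < sphereArea d := sphereArea_pos (by lia)
    -- The alternative is exactly of first order, so the remainder constant is `C = 0`.
    refine tendsto_efficiency hd β (by lia) θ (α := 1) (C := 0) one_ne_zero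
      (fun κ _ => continuous_lpDensity m θ κ)
      (fun κ hκ => lpDensity_nonneg hd m θ (Ioc_subset_Icc_self hκ))
      (fun κ _ => integral_lpDensity hd (by lia) θ κ) fun κ _ x => ?_
    rw [lpDensity, ← mul_assoc, mul_one_div_cancel hS.ne']
    simp
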